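/- Let $1\le p\le M$ and $T\ge 1$ be integers. For $u\in[-1,1]$ let $\mathbf a(u)=(e^{jk\pi u})_{k=0}^{M-1}$, let $\gamma\ge 0$ be an integrable function on $[-1,1]$ with $\int_{-1}^1\gamma>0$, and let $\sigma>0$. Consider the snapshots $$\mathbf y(t)=\int_{-1}^1\sqrt{\gamma(u)}\,\mathbf a(u)\,z(u,t)\,du+\mathbf n(t),\qquad t=0,\dots,T-1,$$ where $z$ is a white circularly symmetric complex Gaussian process with $\mathbb E[z(u,t)z(u',t')^*]=\delta(u-u')\delta_{t,t'}$, and, independently of $z$, the $\mathbf n(t)$ are i.i.d. $\mathcal{CN}(0,\sigma^2 I_M)$. Write $\mathbf Y=[\mathbf y(0),\dots,\mathbf y(T-1)]$, $\mathbf S=\int_{-1}^1\gamma(u)\mathbf a(u)\mathbf a(u)^{\mathsf H}du$ and $\mathsf{snr}=\operatorname{tr}(\mathbf S)/\operatorname{tr}(\sigma^2 I_M)$. Let $\mathcal D\subset\{0,\dots,M-1\}$ be the set of sampled antennas. Assume that it is a complete cover (every $k\in\{0,\dots,M-1\}$ is a difference of two elements of $\mathcal D$) of size $m=|\mathcal D|\le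 2\sqrt M$, the size provided by coprime sampling. Let $\mathbf B$ be the $m\times M$ binary matrix that selects the coordinates in $\mathcal D$ in increasing order, let $\mathbf X=\mathbf B\mathbf Y$ be the observed sketches, and let $\|\mathbf K\|_{\mathbf B}=\|\mathbf B\mathbf K\mathbf B^{\mathsf H}\|$, with the Frobenius norm on the right. The CMP estimator takes the projection $\mathbf C^*$ of the sample covariance $\widehat{\mathbf C}_y=\frac1T\mathbf Y\mathbf Y^{\mathsf H}$ onto the cone of $M\times M$ Hermitian positive semidefinite Toeplitz matrices, that is, the minimizer over $\mathbf C$ in this cone of $\|\widehat{\mathbf C}_y-\mathbf C\|_{\mathbf B}=\|\frac1T\mathbf X\mathbf X^{\mathsf H}-\mathbf B\mathbf C\mathbf B^{\mathsf H}\|$, and returns the $M\times p$ matrix $\widetilde{\mathbf V}_p=\widetilde{\mathbf V}_p(\mathbf X)$ formed by $p$ orthonormal dominant eigenvectors of $\mathbf C^*$ (ties being broken in any measurable way). Let $\mathbf V_p$ maximize $\langle\mathbf S,\mathbf U\mathbf U^{\mathsf H}\rangle=\operatorname{tr}(\mathbf S\mathbf U\mathbf U^{\mathsf H})$ over the $M\times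 p$ matrices $\mathbf U$ with $\mathbf U^{\mathsf H}\mathbf U=I_p$, and put $$\eta_p=\frac{\langle\mathbf S,\mathbf V_p\mathbf V_p^{\mathsf H}\rangle}{\operatorname{tr}(\mathbf S)},\qquad \Gamma_p=\frac{\langle\mathbf S,\widetilde{\mathbf V}_p\widetilde{\mathbf V}_p^{\mathsf H}\rangle}{\langle\mathbf S,\mathbf V_p\mathbf V_p^{\mathsf H}\rangle}.$$ Then $\Gamma_p$ is square integrable and $$\mathbb E[\Gamma_p]\ \ge\ \max\Big\{1-\frac{2\sqrt{2p}}{\eta_p\sqrt T}\Big(1+\frac1{\mathsf{snr}}\Big),\,0\Big\},\qquad \operatorname{Var}[\Gamma_p]\ \le\ \frac{8p}{T\eta_p^2}\Big(1+\frac1{\mathsf{snr}}\Big)^2 .$$ -/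

import Mathlib

open MeasureTheory ProbabilityTheory
open scoped Matrix ComplexConjugate ComplexOrder

noncomputable section

namespace CMP

/-! ### Circularly symmetric complex Gaussian processes -/

/-- The circularly symmetric complex Gaussian law with mean zero and variance `s`: real and
imaginary part are independent centred real Gaussians of variance `s / 2`. -/
def complexGaussian (s : ℝ) : Measure ℂ :=
  ((gaussianReal 0 (Real.toNNReal (s / 2))).prod (gaussianReal 0 (Real.toNNReal (s / 2)))).map
    (fun x : ℝ × ℝ => (x.1 : ℂ) + (x.2 : ℂ) * Complex.I)

/-- The family `X` of complex random variables is a (jointly) circularly symmetric complex Gaussian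
process with covariance function `E[X i * conj (X j)] = K i j`: every finite complex linear
combination `∑ c i * X i` is a circularly symmetric complex Gaussian variable, with the variance
`∑ c i * conj (c j) * K i j` prescribed by `K`. -/
structure IsCircularGaussian {Ω ι : Type*} [MeasurableSpace Ω] (μ : Measure Ω)
    (X : ι → Ω → ℂ) (K : ι → ι → ℂ) : Prop where
  measurable : ∀ i, Measurable (X i)
  law : ∀ (s : Finset ι) (c : ι → ℂ),
    μ.map (fun ω => ∑ i ∈ s, c i * X i ω) =
      complexGaussian (∑ i ∈ s, ∑ j ∈ s, c i * conj (c j) * K i j).re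

/-! ### The channel model -/

/-- Square integrable test functions on `[-1, 1]`. -/
abbrev L2Fun : Type :=
  {g : ℝ → ℂ // MemLp g 2 (volume.restrict (Set.Icc (-1 : ℝ) 1))}

/-- `z (t, g)` is the stochastic integral `∫_{-1}^1 g(u) z(u, t) du` of the white circularly
symmetric Gaussian process with `E[z(u, t) conj z(u', t')] = δ(u - u') δ_{t, t'}`, so that the
covariance of `z (t, g)` and `z (t', h)` is `δ_{t, t'} ∫ g conj h`. -/
def IsWhiteNoise {Ω : Type*} [MeasurableSpace Ω] (μ : Measure Ω) {T : ℕ}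
    (z : Fin T × L2Fun → Ω → ℂ) : Prop :=
  IsCircularGaussian μ z (fun a b =>
    if a.1 = b.1 then ∫ u in Set.Icc (-1 : ℝ) 1, a.2.1 u * conj (b.2.1 u) else 0)

/-- `n (t, k)` are i.i.d. circularly symmetric complex Gaussians of variance `σ ^ 2`, over the
snapshots `t` and the antennas `k`. -/
def IsReceiverNoise {Ω : Type*} [MeasurableSpace Ω] (μ : Measure Ω) {T M : ℕ} (σ : ℝ)
    (n : Fin T × Fin M → Ω → ℂ) : Prop :=
  IsCircularGaussian μ n (fun a b => if a = b then ((σ ^ 2 : ℝ) : ℂ) else 0)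

/-- The array response `[a(u)]_k = exp (j k π u)`. -/
def steering (k : ℕ) (u : ℝ) : ℂ := Complex.exp (Complex.I * k * Real.pi * u)

theorem memLp_sqrt_mul_steering {γ : ℝ → ℝ} (hγ : IntegrableOn γ (Set.Icc (-1 : ℝ) 1)) (k : ℕ) :
    MemLp (fun u => ((Real.sqrt (γ u) : ℝ) : ℂ) * steering k u) 2
      (volume.restrict (Set.Icc (-1 : ℝ) 1)) := by
  have hs : ∀ u, ‖steering k u‖ = 1 := by
    intro u
    have : Complex.I * k * Real.pi * u = ((k * Real.pi * u : ℝ) : ℂ) * Complex.I := by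
      push_cast; ring
    rw [steering, this, Complex.norm_exp_ofReal_mul_I]
  have hc : Continuous (steering k) := by unfold steering; fun_prop
  have hm : AEStronglyMeasurable (fun u => ((Real.sqrt (γ u) : ℝ) : ℂ) * steering k u)
      (volume.restrict (Set.Icc (-1 : ℝ) 1)) :=
    (Complex.continuous_ofReal.comp_aestronglyMeasurable
      (Real.continuous_sqrt.comp_aestronglyMeasurable hγ.aestronglyMeasurable)).mul
      hc.aestronglyMeasurable
  rw [memLp_two_iff_integrable_sq_norm hm]
  refine Integrable.mono hγ (hm.norm.pow 2) (Filter.Eventually.of_forall fun u => ?_)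
  rw [norm_mul, hs, mul_one, Complex.norm_real, Real.norm_of_nonneg (sq_nonneg _),
    Real.norm_eq_abs, sq_abs, Real.norm_eq_abs]
  rcases le_total 0 (γ u) with h | h
  · rw [Real.sq_sqrt h]; exact le_abs_self _
  · simp [Real.sqrt_eq_zero_of_nonpos h]

/-- The function `u ↦ √γ(u) [a(u)]_k` as a test function. -/
def channelFun {γ : ℝ → ℝ} (hγ : IntegrableOn γ (Set.Icc (-1 : ℝ) 1)) (k : ℕ) : L2Fun :=
  ⟨fun u => ((Real.sqrt (γ u) : ℝ) : ℂ) * steering k u, memLp_sqrt_mul_steering hγ k⟩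

/-- The received `M × T` signal, whose column `t` is the snapshot
`y(t) = ∫_{-1}^1 √γ(u) a(u) z(u, t) du + n(t)`. -/
def received {Ω : Type*} {T M : ℕ} {γ : ℝ → ℝ} (hγ : IntegrableOn γ (Set.Icc (-1 : ℝ) 1))
    (z : Fin T × L2Fun → Ω → ℂ) (n : Fin T × Fin M → Ω → ℂ) (ω : Ω) :
    Matrix (Fin M) (Fin T) ℂ :=
  Matrix.of fun k t => z (t, channelFun hγ k) ω + n (t, k) ω

/-- The signal covariance matrix `S(γ) = ∫_{-1}^1 γ(u) a(u) a(u)ᴴ du`. -/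
def signalCov (M : ℕ) (γ : ℝ → ℝ) : Matrix (Fin M) (Fin M) ℂ :=
  Matrix.of fun i k => ∫ u in Set.Icc (-1 : ℝ) 1, (γ u : ℂ) * (steering i u * conj (steering k u))

/-- The signal-to-noise ratio `tr S(γ) / tr (σ² I_M)`. -/
def snr (M : ℕ) (γ : ℝ → ℝ) (σ : ℝ) : ℝ :=
  (signalCov M γ).trace.re / (((σ ^ 2 : ℝ) : ℂ) • (1 : Matrix (Fin M) (Fin M) ℂ)).trace.re

/-! ### Array subsampling -/

/-- Every `k ∈ {0, …, M - 1}` is a difference of two elements of `D`. -/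
def IsCompleteCover {M : ℕ} (D : Finset (Fin M)) : Prop :=
  ∀ k : ℕ, k < M → ∃ i ∈ D, ∃ i' ∈ D, (i : ℕ) = i' + k

/-- The `|D| × M` binary matrix whose row `i` selects the `i`-th element of `D`. -/
def samplingMatrix {M : ℕ} (D : Finset (Fin M)) : Matrix (Fin D.card) (Fin M) ℂ :=
  Matrix.of fun i k => if D.orderEmbOfFin rfl i = k then 1 else 0

/-! ### Beamformers -/

/-- The real part of the inner product `⟨K, L⟩ = tr (K Lᴴ)` (equal to it for Hermitian `K`, `L`). -/
def innerRe {ι κ : Type*} [Fintype ι] [Fintype κ] (K L : Matrix ι κ ℂ) : ℝ :=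
  (K * Lᴴ).trace.re

/-- The signal power `⟨S, V Vᴴ⟩` captured by the beamformer `V`. -/
def capturedPower {M p : ℕ} (S : Matrix (Fin M) (Fin M) ℂ) (V : Matrix (Fin M) (Fin p) ℂ) : ℝ :=
  innerRe S (V * Vᴴ)

/-- `V` maximizes the captured power among the `M × p` matrices with orthonormal columns. -/
def IsBestBeamformer {M p : ℕ} (S : Matrix (Fin M) (Fin M) ℂ) (V : Matrix (Fin M) (Fin p) ℂ) :
    Prop :=
  Vᴴ * V = 1 ∧
    ∀ U : Matrix (Fin M) (Fin p) ℂ, Uᴴ * U = 1 → capturedPower S U ≤ capturedPower S V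

/-- The efficiency `η_p = ⟨S, V Vᴴ⟩ / tr S` of the best beamformer `V`. -/
def efficiency {M p : ℕ} (S : Matrix (Fin M) (Fin M) ℂ) (V : Matrix (Fin M) (Fin p) ℂ) : ℝ :=
  capturedPower S V / S.trace.re

/-- The relative efficiency `Γ_p = ⟨S, V' V'ᴴ⟩ / ⟨S, V Vᴴ⟩` of `V'` with respect to `V`. -/
def relEfficiency {M p : ℕ} (S : Matrix (Fin M) (Fin M) ℂ) (V V' : Matrix (Fin M) (Fin p) ℂ) : ℝ :=
  capturedPower S V' / capturedPower S V

/-! ### Covariance matrix projection -/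

/-- The cone of positive semidefinite Hermitian Toeplitz matrices. -/
def toeplitzCone (M : ℕ) : Set (Matrix (Fin M) (Fin M) ℂ) :=
  {K | K.PosSemidef ∧ ∃ f : ℤ → ℂ, ∀ i j : Fin M, K i j = f ((i : ℤ) - (j : ℤ))}

/-- The seminorm `‖K‖_B = ‖B K Bᴴ‖`, with the Frobenius norm on the right. -/
def seminormB {M : ℕ} (D : Finset (Fin M)) (K : Matrix (Fin M) (Fin M) ℂ) : ℝ :=
  Real.sqrt (innerRe (samplingMatrix D * K * (samplingMatrix D)ᴴ)
    (samplingMatrix D * K * (samplingMatrix D)ᴴ))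

/-- The sample covariance matrix `(1 / T) Y Yᴴ`. -/
def sampleCov {ι : Type*} {T : ℕ} (Y : Matrix ι (Fin T) ℂ) : Matrix ι ι ℂ :=
  ((T : ℂ)⁻¹) • (Y * Yᴴ)

/-- `C` is a projection of `K` onto the positive semidefinite Toeplitz cone under `‖·‖_B`. -/
def IsProjection {M : ℕ} (D : Finset (Fin M)) (K C : Matrix (Fin M) (Fin M) ℂ) : Prop :=
  C ∈ toeplitzCone M ∧ ∀ L ∈ toeplitzCone M, seminormB D (K - C) ≤ seminormB D (K - L)

/-- `V` consists of the first `p` columns of `U` in a decomposition `C = U Λ Uᴴ`, with `U` unitary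
and `Λ` diagonal with non-increasing real entries. -/
def IsDominantBasis {M p : ℕ} (hp : p ≤ M) (C : Matrix (Fin M) (Fin M) ℂ)
    (V : Matrix (Fin M) (Fin p) ℂ) : Prop :=
  ∃ U ∈ Matrix.unitaryGroup (Fin M) ℂ, ∃ lam : Fin M → ℝ, Antitone lam ∧
    C = U * Matrix.diagonal (fun i => (lam i : ℂ)) * Uᴴ ∧
    ∀ i j, V i j = U i (Fin.castLE hp j)

/-- `est`, a measurable function of the sketches `X = B Y` only, is a CMP estimator of the
`p`-dimensional signal subspace: it returns the `p` dominant eigenvectors (ties broken in any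
measurable way) of the projection of the sample covariance matrix of `Y`. -/
structure IsCMPEstimator {M T p : ℕ} (hp : p ≤ M) (D : Finset (Fin M))
    (est : Matrix (Fin D.card) (Fin T) ℂ → Matrix (Fin M) (Fin p) ℂ) : Prop where
  measurable : ∀ i j, Measurable (fun x : Fin D.card → Fin T → ℂ => est (Matrix.of x) i j)
  dominant : ∀ Y : Matrix (Fin M) (Fin T) ℂ, ∃ C : Matrix (Fin M) (Fin M) ℂ,
    IsProjection D (sampleCov Y) C ∧ IsDominantBasis hp C (est (samplingMatrix D * Y))

end CMP

end

/-!
Write `Cy = S + σ² I` for the covariance of a snapshot, `Ĉ` for the sample covariance and `C` for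
its projection onto the Toeplitz cone.

The lost power `⟨S, V Vᴴ - V' V'ᴴ⟩` does not change when `S` is replaced by `Cy`, both projections
having trace `p`. As the dominant eigenvectors `V'` of `C` maximize the power captured from `C`
(`IsDominantBasis.capturedPower_le`), the loss is at most `⟨Cy - C, V Vᴴ - V' V'ᴴ⟩`, hence at most
`√(2 p) ‖Cy - C‖` (`capturedPower_sub_le`). Now `Cy - C` is Toeplitz and the sampled antennas see
each of its diagonals, so `‖Cy - C‖² ≤ M ‖Cy - C‖_B²` (`innerRe_self_le_of_toeplitz`); since `Cy`
lies in the convex cone on which `Ĉ` is projected, `‖Cy - C‖_B ≤ ‖Cy - Ĉ‖_B`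
(`IsProjection.seminormB_sub_le`).

The entries of the snapshots are jointly circularly symmetric Gaussian
(`isCircularGaussian_received`), and Isserlis' formula for their fourth moments
(`IsCircularGaussian.integral_four_linComb`) gives `E |Ĉ i j - Cy i j|² = Cy i i * Cy j j / T`.
Summed over the `m²` sampled entries this is `E ‖Ĉ - Cy‖_B² = (m tr Cy / M)² / T`
(`integral_seminormB_sampleCov_sub_sq`), and `m² ≤ 4 M` turns it into
`E (1 - Γ)² ≤ 8 p (tr Cy)² / (T ⟨S, V Vᴴ⟩²)`, the square of the asserted bound. As `Γ` takes values
in `[0, 1]`, the claims on its mean and variance follow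
(`mean_variance_of_integral_one_sub_sq_le`).

Isserlis' formula is obtained without densities or independence of the snapshots: the law of a
linear combination `w` gives `E |w|⁴ = 2 (E |w|²)²`, and this identity polarizes
(`eq_zero_of_diagonal_eq_zero`).
-/

namespace CMP

/-! ### Fourth moments of complex Gaussian variables -/

theorem integrable_pow_gaussianReal (v : NNReal) (k : ℕ) :
    Integrable (fun x : ℝ => x ^ k) (gaussianReal 0 v) := by
  have h : MemLp id k (gaussianReal 0 v) := memLp_id_gaussianReal' _ (by simp)
  have h2 := h.integrable_norm_pow'
  refine h2.mono' (by fun_prop) (Filter.Eventually.of_forall fun x => ?_)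
  simp

theorem integral_sq_gaussianReal (v : NNReal) :
    ∫ x, x ^ 2 ∂(gaussianReal 0 v) = v := by
  have h := variance_fun_id_gaussianReal (μ := 0) (v := v)
  rwa [variance_of_integral_eq_zero (by fun_prop) (by simp)] at h

/-- If `X`, `Y` are independent centred Gaussians of the same law, then `X + Y` is distributed as
`√2 X`, which determines the fourth moment. -/
theorem integral_pow_four_gaussianReal (v : NNReal) :
    ∫ x, x ^ 4 ∂(gaussianReal 0 v) = 3 * (v : ℝ) ^ 2 := by
  set g := gaussianReal 0 v
  have i1 := integrable_pow_gaussianReal v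
  have h1 : ∫ x, x ^ 4 ∂(g ∗ g) = 4 * ∫ x, x ^ 4 ∂g := by
    have : g ∗ g = g.map (fun x => Real.sqrt 2 * x) := by
      rw [gaussianReal_conv_gaussianReal, gaussianReal_map_const_mul]
      congr 1
      · simp
      · ext; push_cast; simp; ring
    rw [this, integral_map (by fun_prop) (by fun_prop), ← integral_const_mul]
    congr 1; ext x
    rw [mul_pow, show (Real.sqrt 2) ^ 4 = ((Real.sqrt 2) ^ 2) ^ 2 by ring,
      Real.sq_sqrt (by norm_num)]
    norm_num
  have h2 : ∫ x, x ^ 4 ∂(g ∗ g) = 2 * (∫ x, x ^ 4 ∂g) + 6 * (v : ℝ) ^ 2 := by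
    rw [Measure.conv, integral_map (by fun_prop) (by fun_prop)]
    have e : ∀ x : ℝ × ℝ, (x.1 + x.2) ^ 4 = (x.1 ^ 4 * x.2 ^ 0 + x.1 ^ 0 * x.2 ^ 4) +
        (4 * (x.1 ^ 3 * x.2 ^ 1) + 4 * (x.1 ^ 1 * x.2 ^ 3)) + 6 * (x.1 ^ 2 * x.2 ^ 2) := by
      intro x; ring
    have i2 : ∀ a b : ℕ, Integrable (fun x : ℝ × ℝ => x.1 ^ a * x.2 ^ b) (g.prod g) :=
      fun a b => (i1 a).mul_prod (i1 b)
    have e2 : ∀ a b : ℕ, ∫ x : ℝ × ℝ, x.1 ^ a * x.2 ^ b ∂(g.prod g) =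
        (∫ x, x ^ a ∂g) * ∫ x, x ^ b ∂g := fun a b => integral_prod_mul _ _
    simp_rw [e]
    rw [integral_add (by fun_prop) (by fun_prop), integral_add (by fun_prop) (by fun_prop),
      integral_add (by fun_prop) (by fun_prop), integral_add (by fun_prop) (by fun_prop)]
    simp only [integral_const_mul, e2]
    have z1 : ∫ x : ℝ, x ^ 1 ∂g = 0 := by simp [g]
    rw [z1, integral_sq_gaussianReal]
    simp
    ring
  linarith

instance isProbabilityMeasure_complexGaussian (s : ℝ) :
    IsProbabilityMeasure (complexGaussian s) :=
  Measure.isProbabilityMeasure_map (by fun_prop)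

theorem integrable_norm_pow_four_complexGaussian (s : ℝ) :
    Integrable (fun x : ℂ => ‖x‖ ^ 4) (complexGaussian s) := by
  rw [complexGaussian, integrable_map_measure (by fun_prop) (by fun_prop)]
  set g := gaussianReal 0 (Real.toNNReal (s / 2))
  have i1 := integrable_pow_gaussianReal (Real.toNNReal (s / 2))
  have i2 : ∀ a b : ℕ, Integrable (fun x : ℝ × ℝ => x.1 ^ a * x.2 ^ b) (g.prod g) :=
    fun a b => (i1 a).mul_prod (i1 b)
  refine ((i2 4 0).add ((i2 2 2).const_mul 2 |>.add (i2 0 4))).congr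
    (Filter.Eventually.of_forall fun x => ?_)
  have : ‖(x.1 : ℂ) + (x.2 : ℂ) * Complex.I‖ ^ 4 = (x.1 ^ 2 + x.2 ^ 2) ^ 2 := by
    rw [← Complex.normSq_add_mul_I, Complex.normSq_eq_norm_sq]; ring
  simp only [Function.comp, Pi.add_apply, this]; ring

theorem integral_norm_sq_complexGaussian {s : ℝ} (hs : 0 ≤ s) :
    ∫ x, ‖x‖ ^ 2 ∂(complexGaussian s) = s := by
  rw [complexGaussian, integral_map (by fun_prop) (by fun_prop)]
  have i1 := integrable_pow_gaussianReal (Real.toNNReal (s / 2))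
  have e0 := integral_sq_gaussianReal (Real.toNNReal (s / 2))
  set g := gaussianReal 0 (Real.toNNReal (s / 2))
  have i2 : ∀ a b : ℕ, Integrable (fun x : ℝ × ℝ => x.1 ^ a * x.2 ^ b) (g.prod g) :=
    fun a b => (i1 a).mul_prod (i1 b)
  have e2 : ∀ a b : ℕ, ∫ x : ℝ × ℝ, x.1 ^ a * x.2 ^ b ∂(g.prod g) =
      (∫ x, x ^ a ∂g) * ∫ x, x ^ b ∂g := fun a b => integral_prod_mul _ _
  have e : ∀ x : ℝ × ℝ, ‖(x.1 : ℂ) + (x.2 : ℂ) * Complex.I‖ ^ 2 =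
      x.1 ^ 2 * x.2 ^ 0 + x.1 ^ 0 * x.2 ^ 2 := by
    intro x; rw [← Complex.normSq_eq_norm_sq, Complex.normSq_add_mul_I]; ring
  simp_rw [e]
  rw [integral_add (i2 _ _) (i2 _ _), e2, e2, e0]
  simp [Real.coe_toNNReal _ (by positivity : 0 ≤ s / 2)]

theorem integral_norm_pow_four_complexGaussian {s : ℝ} (hs : 0 ≤ s) :
    ∫ x, ‖x‖ ^ 4 ∂(complexGaussian s) = 2 * s ^ 2 := by
  rw [complexGaussian, integral_map (by fun_prop) (by fun_prop)]
  have i1 := integrable_pow_gaussianReal (Real.toNNReal (s / 2))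
  have e0 := integral_sq_gaussianReal (Real.toNNReal (s / 2))
  have e1 := integral_pow_four_gaussianReal (Real.toNNReal (s / 2))
  set g := gaussianReal 0 (Real.toNNReal (s / 2))
  have i2 : ∀ a b : ℕ, Integrable (fun x : ℝ × ℝ => x.1 ^ a * x.2 ^ b) (g.prod g) :=
    fun a b => (i1 a).mul_prod (i1 b)
  have e2 : ∀ a b : ℕ, ∫ x : ℝ × ℝ, x.1 ^ a * x.2 ^ b ∂(g.prod g) =
      (∫ x, x ^ a ∂g) * ∫ x, x ^ b ∂g := fun a b => integral_prod_mul _ _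
  have e : ∀ x : ℝ × ℝ, ‖(x.1 : ℂ) + (x.2 : ℂ) * Complex.I‖ ^ 4 =
      x.1 ^ 4 * x.2 ^ 0 + 2 * (x.1 ^ 2 * x.2 ^ 2) + x.1 ^ 0 * x.2 ^ 4 := by
    intro x
    rw [show ∀ y : ℝ, y ^ 4 = (y ^ 2) ^ 2 by intro y; ring, ← Complex.normSq_eq_norm_sq,
      Complex.normSq_add_mul_I]
    ring
  simp_rw [e]
  rw [integral_add (by fun_prop) (by fun_prop), integral_add (by fun_prop) (by fun_prop),
    integral_const_mul, e2, e2, e2, e0, e1]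
  simp [Real.coe_toNNReal _ (by positivity : 0 ≤ s / 2)]
  ring

theorem charFun_complexGaussian {s : ℝ} (hs : 0 ≤ s) (t : ℂ) :
    charFun (complexGaussian s) t = Complex.exp (-(s * ‖t‖ ^ 2 / 4 : ℝ)) := by
  rw [charFun_apply, complexGaussian, integral_map (by fun_prop) (by fun_prop)]
  set g := gaussianReal 0 (Real.toNNReal (s / 2)) with hg
  have e : ∀ x : ℝ × ℝ, Complex.exp ((inner ℝ ((x.1 : ℂ) + (x.2 : ℂ) * Complex.I) t : ℝ) *
      Complex.I) = Complex.exp (t.re * x.1 * Complex.I) * Complex.exp (t.im * x.2 * Complex.I) := by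
    intro x
    rw [← Complex.exp_add]
    congr 1
    simp [Complex.inner]
    ring
  simp_rw [e]
  rw [integral_prod_mul (fun x : ℝ => Complex.exp (t.re * x * Complex.I))
    (fun x : ℝ => Complex.exp (t.im * x * Complex.I)), ← charFun_apply_real, ← charFun_apply_real,
    hg, charFun_gaussianReal, charFun_gaussianReal, ← Complex.exp_add]
  congr 1
  rw [Real.coe_toNNReal _ (by positivity), ← Complex.normSq_eq_norm_sq, Complex.normSq_apply]
  push_cast
  ring

theorem complexGaussian_conv {s r : ℝ} (hs : 0 ≤ s) (hr : 0 ≤ r) :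
    complexGaussian s ∗ complexGaussian r = complexGaussian (s + r) := by
  refine Measure.ext_of_charFun (funext fun t => ?_)
  rw [charFun_conv, charFun_complexGaussian hs, charFun_complexGaussian hr,
    charFun_complexGaussian (add_nonneg hs hr), ← Complex.exp_add]
  congr 1
  push_cast
  ring

/-! ### Polarization of fourth order forms -/

/-- A form that is linear in the first and third, conjugate linear in the second and fourth
argument, symmetric in each of these pairs, and zero on the diagonal, is zero. -/
theorem eq_zero_of_diagonal_eq_zero {V : Type*} [AddCommGroup V] [Module ℂ V]
    (D : V → V → V → V → ℂ)
    (hadd : ∀ a a' b c d, D (a + a') b c d = D a b c d + D a' b c d)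
    (hsmul : ∀ (r : ℂ) a b c d, D (r • a) b c d = r * D a b c d)
    (hac : ∀ a b c d, D a b c d = D c b a d)
    (hbd : ∀ a b c d, D a b c d = D a d c b)
    (hconj : ∀ a b c d, conj (D a b c d) = D b a d c)
    (h0 : ∀ a, D a a a a = 0) (a b c d : V) : D a b c d = 0 := by
  have addc : ∀ a b c c' d, D a b (c + c') d = D a b c d + D a b c' d := by
    intro a b c c' d; rw [hac, hadd, hac c, hac c']
  have addb : ∀ a b b' c d, D a (b + b') c d = D a b c d + D a b' c d := by
    intro a b b' c d; rw [← hconj, hadd, map_add, hconj, hconj]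
  have addd : ∀ a b c d d', D a b c (d + d') = D a b c d + D a b c d' := by
    intro a b c d d'; rw [hbd, addb, hbd a d, hbd a d']
  have smulc : ∀ (r : ℂ) a b c d, D a b (r • c) d = r * D a b c d := by
    intro r a b c d; rw [hac, hsmul, hac c]
  have smulb : ∀ (r : ℂ) a b c d, D a (r • b) c d = conj r * D a b c d := by
    intro r a b c d; rw [← hconj, hsmul, map_mul, hconj]
  have smuld : ∀ (r : ℂ) a b c d, D a b c (r • d) = conj r * D a b c d := by
    intro r a b c d; rw [hbd, smulb, hbd a d]
  -- The expansion of the diagonal at `x + r • y`, averaged over the fourth roots of unity `r` with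
  -- the weights `r ^ 2`, keeps only the two terms below.
  have key : ∀ x y, D y x y x + D x y x y = 0 := by
    intro x y
    have ex : ∀ r : ℂ, D (x + r • y) (x + r • y) (x + r • y) (x + r • y) = 0 := fun r => h0 _
    simp only [hadd, addb, addc, addd, hsmul, smulb, smulc, smuld] at ex
    have e1 := ex 1
    have e2 := ex (-1)
    have e3 := ex Complex.I
    have e4 := ex (-Complex.I)
    simp only [map_neg, map_one, Complex.conj_I, neg_neg] at e1 e2 e3 e4
    have hI : Complex.I * Complex.I = -1 := Complex.I_mul_I
    grind
  have diag : ∀ x y, D y x y x = 0 := by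
    intro x y
    have h1 := key x y
    have h2 := key x ((1 + Complex.I) • y)
    simp only [hsmul, smulb, smulc, smuld, map_add, map_one, Complex.conj_I] at h2
    have hI : Complex.I * Complex.I = -1 := Complex.I_mul_I
    have h3 : Complex.I * (D y x y x - D x y x y) = 0 := by
      linear_combination h2 / 2 - (D y x y x + D x y x y) / 2 * hI
    have h4 := (mul_eq_zero.mp h3).resolve_left Complex.I_ne_zero
    linear_combination (h1 + h4) / 2
  have half : ∀ x y y', D y x y' x = 0 := by
    intro x y y'
    have h := diag x (y + y')
    rw [hadd, addc, addc, diag, diag, hac y' x y x] at h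
    linear_combination h / 2
  have h := half (b + d) a c
  rw [addb, addd, addd, half, half, hbd a d c b] at h
  linear_combination h / 2


/-- A sesquilinear form that is zero on the diagonal is zero. -/
theorem sesqForm_eq_zero_of_diagonal_eq_zero {V : Type*} [AddCommGroup V] [Module ℂ V]
    (D : V → V → ℂ)
    (hadd : ∀ a a' b, D (a + a') b = D a b + D a' b)
    (hsmul : ∀ (r : ℂ) a b, D (r • a) b = r * D a b)
    (hconj : ∀ a b, conj (D a b) = D b a)
    (h0 : ∀ a, D a a = 0) (a b : V) : D a b = 0 := by
  have addb : ∀ a b b', D a (b + b') = D a b + D a b' := by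
    intro a b b'; rw [← hconj, hadd, map_add, hconj, hconj]
  have smulb : ∀ (r : ℂ) a b, D a (r • b) = conj r * D a b := by
    intro r a b; rw [← hconj, hsmul, map_mul, hconj]
  have e1 := h0 (a + b)
  have e2 := h0 (a + Complex.I • b)
  simp only [hadd, addb, hsmul, smulb, h0, Complex.conj_I] at e1 e2
  have e3 : Complex.I * (D b a - D a b) = 0 := by linear_combination e2
  have e4 := (mul_eq_zero.mp e3).resolve_left Complex.I_ne_zero
  linear_combination (e1 - e4) / 2

/-! ### Moments of circularly symmetric Gaussian families -/

/-- The Hermitian form `∑ a i * conj (b j) * K i j` with kernel `K`. -/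
def kernelForm {ι : Type*} [Fintype ι] (K : ι → ι → ℂ) (a b : ι → ℂ) : ℂ :=
  ∑ i, ∑ j, a i * conj (b j) * K i j

/-- The linear combination `∑ c i * X i`. -/
def linComb {Ω ι : Type*} [Fintype ι] (X : ι → Ω → ℂ) (c : ι → ℂ) (ω : Ω) : ℂ :=
  ∑ i, c i * X i ω

section Forms

variable {Ω ι : Type*} [Fintype ι]

theorem linComb_add (X : ι → Ω → ℂ) (a b : ι → ℂ) (ω : Ω) :
    linComb X (a + b) ω = linComb X a ω + linComb X b ω := by
  simp [linComb, add_mul, Finset.sum_add_distrib]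

theorem linComb_smul (X : ι → Ω → ℂ) (r : ℂ) (a : ι → ℂ) (ω : Ω) :
    linComb X (r • a) ω = r * linComb X a ω := by
  simp [linComb, mul_assoc, Finset.mul_sum]

theorem linComb_single [DecidableEq ι] (X : ι → Ω → ℂ) (i : ι) :
    linComb X (Pi.single i 1) = X i := by
  ext ω; simp [linComb, Pi.single_apply]

theorem kernelForm_add (K : ι → ι → ℂ) (a a' b : ι → ℂ) :
    kernelForm K (a + a') b = kernelForm K a b + kernelForm K a' b := by
  simp [kernelForm, add_mul, Finset.sum_add_distrib]

theorem kernelForm_smul (K : ι → ι → ℂ) (r : ℂ) (a b : ι → ℂ) :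
    kernelForm K (r • a) b = r * kernelForm K a b := by
  simp [kernelForm, mul_assoc, Finset.mul_sum]

theorem kernelForm_single [DecidableEq ι] (K : ι → ι → ℂ) (i j : ι) :
    kernelForm K (Pi.single i 1) (Pi.single j 1) = K i j := by
  simp [kernelForm, Pi.single_apply, apply_ite (starRingEnd ℂ)]

theorem conj_kernelForm {K : ι → ι → ℂ} (hK : (Matrix.of K).PosSemidef) (a b : ι → ℂ) :
    conj (kernelForm K a b) = kernelForm K b a := by
  have h : ∀ i j, conj (K i j) = K j i := fun i j => hK.isHermitian.apply j i
  rw [kernelForm, kernelForm, Finset.sum_comm]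
  simp only [map_sum, map_mul, h, Complex.conj_conj]
  exact Finset.sum_congr rfl fun i _ => Finset.sum_congr rfl fun j _ => by ring

theorem kernelForm_self_nonneg {K : ι → ι → ℂ} (hK : (Matrix.of K).PosSemidef) (a : ι → ℂ) :
    0 ≤ kernelForm K a a := by
  have h := hK.dotProduct_mulVec_nonneg (fun i => conj (a i))
  convert h using 1
  simp only [kernelForm, dotProduct, Matrix.mulVec, Finset.mul_sum, Pi.star_apply]
  exact Finset.sum_congr rfl fun i _ => Finset.sum_congr rfl fun j _ => by
    simp [mul_comm, mul_left_comm]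

end Forms

theorem integrable_mul_conj_mul_conj {Ω : Type*} [MeasurableSpace Ω] {μ : Measure Ω}
    {f g h k : Ω → ℂ} (hf : Measurable f) (hg : Measurable g) (hh : Measurable h)
    (hk : Measurable k) (hf4 : Integrable (fun ω => ‖f ω‖ ^ 4) μ)
    (hg4 : Integrable (fun ω => ‖g ω‖ ^ 4) μ) (hh4 : Integrable (fun ω => ‖h ω‖ ^ 4) μ)
    (hk4 : Integrable (fun ω => ‖k ω‖ ^ 4) μ) :
    Integrable (fun ω => f ω * conj (g ω) * (h ω * conj (k ω))) μ := by
  have hm : Measurable (fun ω => f ω * conj (g ω) * (h ω * conj (k ω))) :=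
    (hf.mul (Complex.continuous_conj.measurable.comp hg)).mul
      (hh.mul (Complex.continuous_conj.measurable.comp hk))
  refine ((hf4.add hg4).add (hh4.add hk4)).mono' hm.aestronglyMeasurable
    (Filter.Eventually.of_forall fun ω => ?_)
  simp only [norm_mul, RCLike.norm_conj, Pi.add_apply]
  have h1 := norm_nonneg (f ω)
  nlinarith [sq_nonneg (‖f ω‖ * ‖g ω‖ - ‖h ω‖ * ‖k ω‖), sq_nonneg (‖f ω‖ ^ 2 - ‖g ω‖ ^ 2),
    sq_nonneg (‖h ω‖ ^ 2 - ‖k ω‖ ^ 2), sq_nonneg (‖f ω‖ ^ 2), sq_nonneg (‖g ω‖ ^ 2),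
    sq_nonneg (‖h ω‖ ^ 2), sq_nonneg (‖k ω‖ ^ 2)]

namespace IsCircularGaussian

variable {Ω ι : Type*} [MeasurableSpace Ω] {μ : Measure Ω} {X : ι → Ω → ℂ} {K : ι → ι → ℂ}

/-- Reindexing along a map that need not be injective. -/
theorem comp {κ : Type*} (h : IsCircularGaussian μ X K) (f : κ → ι) :
    IsCircularGaussian μ (fun a => X (f a)) (fun a b => K (f a) (f b)) := by
  classical
  refine ⟨fun i => h.measurable _, fun s c => ?_⟩
  set d : ι → ℂ := fun j => ∑ i ∈ s with f i = j, c i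
  have hm : ∀ i ∈ s, f i ∈ s.image f := fun i hi => Finset.mem_image_of_mem f hi
  have key : ∀ g : ι → ℂ, ∑ j ∈ s.image f, d j * g j = ∑ i ∈ s, c i * g (f i) := by
    intro g
    rw [← Finset.sum_fiberwise_of_maps_to hm]
    refine Finset.sum_congr rfl fun j _ => ?_
    rw [Finset.sum_mul]
    refine Finset.sum_congr rfl fun i hi => ?_
    rw [(Finset.mem_filter.mp hi).2]
  have h1 := h.law (s.image f) d
  have h2 : (∑ i ∈ s.image f, ∑ j ∈ s.image f, d i * conj (d j) * K i j) =
      ∑ i ∈ s, ∑ j ∈ s, c i * conj (c j) * K (f i) (f j) := by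
    have key' : ∀ g : ι → ℂ, ∑ j ∈ s.image f, conj (d j) * g j =
        ∑ i ∈ s, conj (c i) * g (f i) := by
      intro g
      have := congrArg conj (key (fun j => conj (g j)))
      simpa [map_sum] using this
    simp_rw [mul_assoc, ← Finset.mul_sum, key', key]
  rw [h2] at h1
  rw [← h1]
  congr 1
  ext ω
  exact (key (fun j => X j ω)).symm

variable [Fintype ι]

theorem measurable_linComb (h : IsCircularGaussian μ X K) (c : ι → ℂ) :
    Measurable (linComb X c) :=
  Finset.measurable_sum _ fun i _ => (h.measurable i).const_mul _

theorem map_linComb (h : IsCircularGaussian μ X K) (c : ι → ℂ) :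
    μ.map (linComb X c) = complexGaussian (kernelForm K c c).re :=
  h.law Finset.univ c

/-- Sum of two independent families. -/
theorem add [IsProbabilityMeasure μ] {Z : ι → Ω → ℂ} {L : ι → ι → ℂ}
    (hX : IsCircularGaussian μ X K)
    (hZ : IsCircularGaussian μ Z L) (hK : (Matrix.of K).PosSemidef)
    (hL : (Matrix.of L).PosSemidef)
    (hXZ : IndepFun (fun ω i => X i ω) (fun ω i => Z i ω) μ) :
    IsCircularGaussian μ (fun i ω => X i ω + Z i ω) (fun i j => K i j + L i j) := by
  classical
  refine ⟨fun i => (hX.measurable i).add (hZ.measurable i), fun s c => ?_⟩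
  set d : ι → ℂ := fun i => if i ∈ s then c i else 0
  have hd : ∀ g : ι → ℂ, ∑ i ∈ s, c i * g i = ∑ i, d i * g i := by
    intro g; simp [d, Finset.sum_ite_mem]
  have hd2 : ∀ g : ι → ℂ, ∑ i ∈ s, conj (c i) * g i = ∑ i, conj (d i) * g i := by
    intro g
    simpa [map_sum] using congrArg conj (hd fun i => conj (g i))
  have hv : ∑ i ∈ s, ∑ j ∈ s, c i * conj (c j) * (K i j + L i j) =
      kernelForm K d d + kernelForm L d d := by
    rw [kernelForm, kernelForm, ← Finset.sum_add_distrib]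
    simp_rw [← Finset.sum_add_distrib, mul_assoc, ← mul_add, ← Finset.mul_sum, hd2, hd]
  have hind : IndepFun (linComb X d) (linComb Z d) μ := by
    have hφ : Measurable (fun x : ι → ℂ => ∑ i, d i * x i) :=
      Finset.measurable_sum _ fun i _ => (measurable_pi_apply i).const_mul _
    exact hXZ.comp hφ hφ
  have hsum : (fun ω => ∑ i ∈ s, c i * (X i ω + Z i ω)) = linComb X d + linComb Z d := by
    ext ω
    rw [hd (fun i => X i ω + Z i ω)]
    simp [linComb, mul_add, Finset.sum_add_distrib]
  rw [hsum, hind.map_add_eq_map_conv_map (hX.measurable_linComb d) (hZ.measurable_linComb d),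
    hX.map_linComb, hZ.map_linComb, complexGaussian_conv, hv, Complex.add_re]
  · exact (Complex.nonneg_iff.mp (kernelForm_self_nonneg hK d)).1
  · exact (Complex.nonneg_iff.mp (kernelForm_self_nonneg hL d)).1

theorem integrable_norm_pow_four_linComb (h : IsCircularGaussian μ X K) (c : ι → ℂ) :
    Integrable (fun ω => ‖linComb X c ω‖ ^ 4) μ := by
  have h1 := integrable_norm_pow_four_complexGaussian (kernelForm K c c).re
  rw [← h.map_linComb] at h1
  exact h1.comp_measurable (h.measurable_linComb c)

theorem integrable_mul_conj_linComb [IsProbabilityMeasure μ] (h : IsCircularGaussian μ X K)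
    (a b : ι → ℂ) : Integrable (fun ω => linComb X a ω * conj (linComb X b ω)) μ := by
  have h1 := integrable_mul_conj_mul_conj (k := fun _ => 1) (h := fun _ => 1)
    (h.measurable_linComb a) (h.measurable_linComb b)
    measurable_const measurable_const (h.integrable_norm_pow_four_linComb a)
    (h.integrable_norm_pow_four_linComb b) (integrable_const _) (integrable_const _)
  simpa using h1

theorem integrable_four_linComb (h : IsCircularGaussian μ X K) (a b c d : ι → ℂ) :
    Integrable (fun ω => linComb X a ω * conj (linComb X b ω) *
      (linComb X c ω * conj (linComb X d ω))) μ :=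
  integrable_mul_conj_mul_conj (h.measurable_linComb a) (h.measurable_linComb b)
    (h.measurable_linComb c) (h.measurable_linComb d) (h.integrable_norm_pow_four_linComb a)
    (h.integrable_norm_pow_four_linComb b) (h.integrable_norm_pow_four_linComb c)
    (h.integrable_norm_pow_four_linComb d)

theorem ofReal_re_kernelForm (hK : (Matrix.of K).PosSemidef) (c : ι → ℂ) :
    ((kernelForm K c c).re : ℂ) = kernelForm K c c := by
  have h := (Complex.nonneg_iff.mp (kernelForm_self_nonneg hK c)).2
  exact Complex.ext rfl (by simpa using h)

theorem integral_mul_conj_linComb [IsProbabilityMeasure μ] (h : IsCircularGaussian μ X K)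
    (hK : (Matrix.of K).PosSemidef) (a b : ι → ℂ) :
    ∫ ω, linComb X a ω * conj (linComb X b ω) ∂μ = kernelForm K a b := by
  refine sub_eq_zero.mp (sesqForm_eq_zero_of_diagonal_eq_zero (fun a b =>
    ∫ ω, linComb X a ω * conj (linComb X b ω) ∂μ - kernelForm K a b) ?_ ?_ ?_ ?_ a b)
  · intro a a' b
    simp only [linComb_add, add_mul, kernelForm_add]
    rw [integral_add (h.integrable_mul_conj_linComb _ _) (h.integrable_mul_conj_linComb _ _)]
    ring
  · intro r a b
    simp only [linComb_smul, mul_assoc, kernelForm_smul]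
    rw [integral_const_mul]
    ring
  · intro a b
    simp only [map_sub, conj_kernelForm hK, ← integral_conj, map_mul, Complex.conj_conj]
    simp only [mul_comm]
  · intro a
    have h1 := integral_norm_sq_complexGaussian
      (Complex.nonneg_iff.mp (kernelForm_self_nonneg hK a)).1
    rw [← h.map_linComb, integral_map (h.measurable_linComb a).aemeasurable (by fun_prop)] at h1
    simp only [Complex.mul_conj, Complex.normSq_eq_norm_sq]
    rw [integral_complex_ofReal, h1, ofReal_re_kernelForm hK, sub_self]

/-- Isserlis' formula for fourth moments: both sides are symmetric forms that agree on the
diagonal, where the claim is `E‖w‖⁴ = 2 (E‖w‖²)²`. -/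
theorem integral_four_linComb [IsProbabilityMeasure μ] (h : IsCircularGaussian μ X K)
    (hK : (Matrix.of K).PosSemidef) (a b c d : ι → ℂ) :
    ∫ ω, linComb X a ω * conj (linComb X b ω) * (linComb X c ω * conj (linComb X d ω)) ∂μ =
      kernelForm K a b * kernelForm K c d + kernelForm K a d * kernelForm K c b := by
  refine sub_eq_zero.mp (eq_zero_of_diagonal_eq_zero (fun a b c d =>
    ∫ ω, linComb X a ω * conj (linComb X b ω) * (linComb X c ω * conj (linComb X d ω)) ∂μ -
      (kernelForm K a b * kernelForm K c d + kernelForm K a d * kernelForm K c b))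
      ?_ ?_ ?_ ?_ ?_ ?_ a b c d)
  · intro a a' b c d
    simp only [linComb_add, add_mul, kernelForm_add]
    rw [integral_add (h.integrable_four_linComb _ _ _ _) (h.integrable_four_linComb _ _ _ _)]
    ring
  · intro r a b c d
    simp only [linComb_smul, mul_assoc, kernelForm_smul]
    rw [integral_const_mul]
    ring
  · intro a b c d
    congr 1
    · exact integral_congr_ae (Filter.Eventually.of_forall fun ω => by ring)
    · ring
  · intro a b c d
    congr 1
    · exact integral_congr_ae (Filter.Eventually.of_forall fun ω => by ring)
    · ring
  · intro a b c d
    simp only [map_sub, map_add, map_mul, conj_kernelForm hK, ← integral_conj, Complex.conj_conj]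
    congr 1
    · exact integral_congr_ae (Filter.Eventually.of_forall fun ω => by ring)
    · ring
  · intro a
    have h1 := integral_norm_pow_four_complexGaussian
      (Complex.nonneg_iff.mp (kernelForm_self_nonneg hK a)).1
    rw [← h.map_linComb, integral_map (h.measurable_linComb a).aemeasurable (by fun_prop)] at h1
    have e : ∀ x : ℂ, x * conj x * (x * conj x) = ((‖x‖ ^ 4 : ℝ) : ℂ) := by
      intro x; rw [Complex.mul_conj, Complex.normSq_eq_norm_sq]; push_cast; ring
    simp only [e]
    rw [integral_complex_ofReal, h1]
    push_cast
    rw [ofReal_re_kernelForm hK]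
    ring

theorem integrable_mul_conj [IsProbabilityMeasure μ] (h : IsCircularGaussian μ X K) (i j : ι) :
    Integrable (fun ω => X i ω * conj (X j ω)) μ := by
  classical
  simpa only [linComb_single] using h.integrable_mul_conj_linComb (Pi.single i 1) (Pi.single j 1)

theorem integral_mul_conj [IsProbabilityMeasure μ] (h : IsCircularGaussian μ X K)
    (hK : (Matrix.of K).PosSemidef) (i j : ι) : ∫ ω, X i ω * conj (X j ω) ∂μ = K i j := by
  classical
  simpa only [linComb_single, kernelForm_single] using
    h.integral_mul_conj_linComb hK (Pi.single i 1) (Pi.single j 1)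

theorem integrable_four (h : IsCircularGaussian μ X K) (i j k l : ι) :
    Integrable (fun ω => X i ω * conj (X j ω) * (X k ω * conj (X l ω))) μ := by
  classical
  simpa only [linComb_single] using h.integrable_four_linComb (Pi.single i 1) (Pi.single j 1)
    (Pi.single k 1) (Pi.single l 1)

theorem integral_four [IsProbabilityMeasure μ] (h : IsCircularGaussian μ X K)
    (hK : (Matrix.of K).PosSemidef) (i j k l : ι) :
    ∫ ω, X i ω * conj (X j ω) * (X k ω * conj (X l ω)) ∂μ = K i j * K k l + K i l * K k j := by
  classical
  simpa only [linComb_single, kernelForm_single] using h.integral_four_linComb hK (Pi.single i 1)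
    (Pi.single j 1) (Pi.single k 1) (Pi.single l 1)

end IsCircularGaussian


/-! ### The real inner product of matrices -/

section InnerRe

variable {ι κ : Type*} [Fintype ι] [Fintype κ]

theorem innerRe_eq_sum (K L : Matrix ι κ ℂ) :
    innerRe K L = ∑ i, ∑ j, (K i j * conj (L i j)).re := by
  simp [innerRe, Matrix.trace, Matrix.mul_apply]

theorem innerRe_self_eq_sum (K : Matrix ι κ ℂ) : innerRe K K = ∑ i, ∑ j, ‖K i j‖ ^ 2 := by
  simp only [innerRe_eq_sum, Complex.mul_conj, Complex.ofReal_re, Complex.normSq_eq_norm_sq]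

theorem innerRe_self_nonneg (K : Matrix ι κ ℂ) : 0 ≤ innerRe K K := by
  rw [innerRe_self_eq_sum]; positivity

theorem innerRe_comm (K L : Matrix ι κ ℂ) : innerRe K L = innerRe L K := by
  simp only [innerRe_eq_sum]
  refine Finset.sum_congr rfl fun i _ => Finset.sum_congr rfl fun j _ => ?_
  simp; ring

theorem innerRe_sub_left (K K' L : Matrix ι κ ℂ) :
    innerRe (K - K') L = innerRe K L - innerRe K' L := by
  simp [innerRe, Matrix.sub_mul]

theorem innerRe_sub_right (K L L' : Matrix ι κ ℂ) :
    innerRe K (L - L') = innerRe K L - innerRe K L' := by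
  simp [innerRe, Matrix.mul_sub]

theorem innerRe_smul_left (s : ℝ) (K L : Matrix ι κ ℂ) :
    innerRe ((s : ℂ) • K) L = s * innerRe K L := by
  simp [innerRe]

theorem innerRe_smul_right (s : ℝ) (K L : Matrix ι κ ℂ) :
    innerRe K ((s : ℂ) • L) = s * innerRe K L := by
  rw [innerRe_comm, innerRe_smul_left, innerRe_comm]

theorem innerRe_le_sqrt_mul_sqrt (K L : Matrix ι κ ℂ) :
    innerRe K L ≤ √(innerRe K K) * √(innerRe L L) := by
  have h : ∀ t : ℝ, 0 ≤ innerRe L L * (t * t) + (-2 * innerRe K L) * t + innerRe K K := by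
    intro t
    have h := innerRe_self_nonneg (K - (t : ℂ) • L)
    simp only [innerRe_sub_left, innerRe_sub_right, innerRe_smul_left, innerRe_smul_right,
      innerRe_comm L K] at h
    linarith
  have hd := discrim_le_zero h
  rw [discrim] at hd
  rw [← Real.sqrt_mul (innerRe_self_nonneg K)]
  exact Real.le_sqrt_of_sq_le (by nlinarith)

/-- Metric projection onto a convex set is nonexpansive towards the points of the set: if no point
of the segment from `0` to `b` is closer to `a` than `0`, then `‖b‖ ≤ ‖a - b‖`. -/
theorem innerRe_self_le_of_segment (a b : Matrix ι κ ℂ)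
    (h : ∀ s : ℝ, 0 < s → s ≤ 1 →
      innerRe a a ≤ innerRe (a - (s : ℂ) • b) (a - (s : ℂ) • b)) :
    innerRe b b ≤ innerRe (a - b) (a - b) := by
  have hb := innerRe_self_nonneg b
  have e : ∀ s : ℝ, 0 < s → s ≤ 1 → 2 * innerRe a b ≤ s * innerRe b b := by
    intro s h0 h1
    have h2 := h s h0 h1
    simp only [innerRe_sub_left, innerRe_sub_right, innerRe_smul_left, innerRe_smul_right,
      innerRe_comm b a] at h2
    have h3 : s * (2 * innerRe a b) ≤ s * (s * innerRe b b) := by linarith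
    exact le_of_mul_le_mul_left h3 h0
  have h0 : innerRe a b ≤ 0 := by
    by_contra! hpos
    have hbb : 0 < innerRe b b := by linarith [e 1 one_pos le_rfl]
    have hs := e (min 1 (innerRe a b / innerRe b b)) (by positivity) (min_le_left _ _)
    have hs' : min 1 (innerRe a b / innerRe b b) * innerRe b b ≤ innerRe a b := by
      calc _ ≤ innerRe a b / innerRe b b * innerRe b b := by gcongr; exact min_le_right _ _
        _ = _ := div_mul_cancel₀ _ hbb.ne'
    linarith
  simp only [innerRe_sub_left, innerRe_sub_right, innerRe_comm b a]
  linarith [innerRe_self_nonneg a]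

end InnerRe

/-! ### Projection onto the Toeplitz cone -/

section Toeplitz

variable {M : ℕ} {D : Finset (Fin M)}

theorem samplingMatrix_conj_apply (K : Matrix (Fin M) (Fin M) ℂ) (i j : Fin D.card) :
    (samplingMatrix D * K * (samplingMatrix D)ᴴ) i j =
      K (D.orderEmbOfFin rfl i) (D.orderEmbOfFin rfl j) := by
  simp [samplingMatrix, Matrix.mul_apply, apply_ite (starRingEnd ℂ)]

theorem sum_orderEmbOfFin (D : Finset (Fin M)) (g : Fin M → ℝ) :
    ∑ i, g (D.orderEmbOfFin rfl i) = ∑ a ∈ D, g a := by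
  conv_rhs => rw [← Finset.map_orderEmbOfFin_univ D rfl]
  rw [Finset.sum_map]
  rfl

theorem seminormB_sq (K : Matrix (Fin M) (Fin M) ℂ) :
    seminormB D K ^ 2 = ∑ a ∈ D, ∑ b ∈ D, ‖K a b‖ ^ 2 := by
  rw [seminormB, Real.sq_sqrt (innerRe_self_nonneg _), innerRe_self_eq_sum,
    ← sum_orderEmbOfFin D (fun a => ∑ b ∈ D, ‖K a b‖ ^ 2)]
  refine Finset.sum_congr rfl fun i _ => ?_
  rw [← sum_orderEmbOfFin D (fun b => ‖K (D.orderEmbOfFin rfl i) b‖ ^ 2)]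
  simp only [samplingMatrix_conj_apply]

theorem add_mem_toeplitzCone {K L : Matrix (Fin M) (Fin M) ℂ} (hK : K ∈ toeplitzCone M)
    (hL : L ∈ toeplitzCone M) : K + L ∈ toeplitzCone M := by
  obtain ⟨hK, f, hf⟩ := hK
  obtain ⟨hL, g, hg⟩ := hL
  exact ⟨hK.add hL, f + g, fun i j => by simp [hf, hg]⟩

theorem smul_mem_toeplitzCone {K : Matrix (Fin M) (Fin M) ℂ} (hK : K ∈ toeplitzCone M)
    {s : ℝ} (hs : 0 ≤ s) : (s : ℂ) • K ∈ toeplitzCone M := by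
  obtain ⟨hK, f, hf⟩ := hK
  exact ⟨hK.smul (by exact_mod_cast hs), (s : ℂ) • f, fun i j => by simp [hf]⟩

theorem one_mem_toeplitzCone : (1 : Matrix (Fin M) (Fin M) ℂ) ∈ toeplitzCone M :=
  ⟨.one, fun k => if k = 0 then 1 else 0, fun i j => by
    simp [Matrix.one_apply, sub_eq_zero, Fin.ext_iff]⟩

theorem IsProjection.seminormB_sub_le {K C L : Matrix (Fin M) (Fin M) ℂ}
    (h : IsProjection D K C) (hL : L ∈ toeplitzCone M) :
    seminormB D (C - L) ≤ seminormB D (K - L) := by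
  have e : ∀ A : Matrix (Fin M) (Fin M) ℂ, samplingMatrix D * -A * (samplingMatrix D)ᴴ =
      -(samplingMatrix D * A * (samplingMatrix D)ᴴ) := by intro A; simp
  have key := innerRe_self_le_of_segment (samplingMatrix D * (K - C) * (samplingMatrix D)ᴴ)
    (samplingMatrix D * (L - C) * (samplingMatrix D)ᴴ) ?_
  · rw [← Matrix.sub_mul, ← Matrix.mul_sub, sub_sub_sub_cancel_right, ← neg_sub C L, e] at key
    refine Real.sqrt_le_sqrt ?_
    simpa [innerRe] using key
  · intro s h0 h1
    have hmem : ((1 - s : ℝ) : ℂ) • C + (s : ℂ) • L ∈ toeplitzCone M :=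
      add_mem_toeplitzCone (smul_mem_toeplitzCone h.1 (by linarith))
        (smul_mem_toeplitzCone hL h0.le)
    have h2 := (Real.sqrt_le_sqrt_iff (innerRe_self_nonneg _)).mp (h.2 _ hmem)
    have h3 : samplingMatrix D * (K - C) * (samplingMatrix D)ᴴ -
        (s : ℂ) • (samplingMatrix D * (L - C) * (samplingMatrix D)ᴴ) =
        samplingMatrix D * (K - (((1 - s : ℝ) : ℂ) • C + (s : ℂ) • L)) * (samplingMatrix D)ᴴ := by
      rw [← Matrix.smul_mul, ← Matrix.mul_smul, ← Matrix.sub_mul, ← Matrix.mul_sub]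
      congr 2
      push_cast
      module
    rw [h3]
    exact h2

/-- For a complete cover, each diagonal of a Toeplitz matrix occurs among the sampled entries,
and it has at most `M` entries. -/
theorem innerRe_self_le_of_toeplitz (hcover : IsCompleteCover D)
    {K : Matrix (Fin M) (Fin M) ℂ} {f : ℤ → ℂ} (hf : ∀ i j : Fin M, K i j = f ((i : ℤ) - (j : ℤ))) :
    innerRe K K ≤ M * seminormB D K ^ 2 := by
  have hcov : ∀ i j : Fin M, ∃ q ∈ D ×ˢ D, ((q.1 : ℕ) : ℤ) - ((q.2 : ℕ) : ℤ) = (i : ℤ) - j := by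
    intro i j
    rcases le_total (j : ℕ) i with hij | hij
    · obtain ⟨a, ha, b, hb, hab⟩ := hcover (i - j) (by omega)
      exact ⟨(a, b), Finset.mk_mem_product ha hb, by simp only; omega⟩
    · obtain ⟨a, ha, b, hb, hab⟩ := hcover (j - i) (by omega)
      exact ⟨(b, a), Finset.mk_mem_product hb ha, by simp only; omega⟩
  choose φ hφ hφ' using hcov
  have hrow : ∀ i : Fin M, ∑ j, ‖K i j‖ ^ 2 ≤ seminormB D K ^ 2 := by
    intro i
    have hinj : Function.Injective (φ i) := by
      intro j j' h
      have h1 := hφ' i j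
      rw [h, hφ' i j'] at h1
      exact Fin.ext (by omega)
    calc ∑ j, ‖K i j‖ ^ 2 = ∑ j, ‖K (φ i j).1 (φ i j).2‖ ^ 2 := by
          refine Finset.sum_congr rfl fun j _ => ?_
          rw [hf, hf, hφ' i j]
      _ = ∑ q ∈ Finset.univ.image (φ i), ‖K q.1 q.2‖ ^ 2 :=
          (Finset.sum_image (f := fun q : Fin M × Fin M => ‖K q.1 q.2‖ ^ 2) hinj.injOn).symm
      _ ≤ ∑ q ∈ D ×ˢ D, ‖K q.1 q.2‖ ^ 2 := by
          refine Finset.sum_le_sum_of_subset_of_nonneg ?_ fun _ _ _ => by positivity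
          intro q hq
          obtain ⟨j, -, rfl⟩ := Finset.mem_image.mp hq
          exact hφ i j
      _ = seminormB D K ^ 2 := by rw [seminormB_sq, Finset.sum_product]
  rw [innerRe_self_eq_sum]
  calc ∑ i, ∑ j, ‖K i j‖ ^ 2 ≤ ∑ _i : Fin M, seminormB D K ^ 2 :=
        Finset.sum_le_sum fun i _ => hrow i
    _ = _ := by simp

theorem IsProjection.innerRe_sub_le {K C L : Matrix (Fin M) (Fin M) ℂ}
    (hcover : IsCompleteCover D) (h : IsProjection D K C) (hL : L ∈ toeplitzCone M) :
    innerRe (C - L) (C - L) ≤ M * seminormB D (K - L) ^ 2 := by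
  obtain ⟨f, hf⟩ := h.1.2
  obtain ⟨g, hg⟩ := hL.2
  have h1 := innerRe_self_le_of_toeplitz hcover (K := C - L) (f := f - g)
    (fun i j => by simp [hf, hg])
  refine h1.trans ?_
  have h2 := h.seminormB_sub_le hL
  have h3 : 0 ≤ seminormB D (C - L) := Real.sqrt_nonneg _
  gcongr

end Toeplitz

/-! ### Captured power of orthonormal beamformers -/

section Beamformers

variable {M p : ℕ}

theorem capturedPower_eq (S : Matrix (Fin M) (Fin M) ℂ) (V : Matrix (Fin M) (Fin p) ℂ) :
    capturedPower S V = (Vᴴ * S * V).trace.re := by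
  rw [capturedPower, innerRe, Matrix.conjTranspose_mul, Matrix.conjTranspose_conjTranspose,
    ← Matrix.mul_assoc, Matrix.trace_mul_comm, Matrix.mul_assoc]

theorem capturedPower_nonneg {S : Matrix (Fin M) (Fin M) ℂ} (hS : S.PosSemidef)
    (V : Matrix (Fin M) (Fin p) ℂ) : 0 ≤ capturedPower S V := by
  rw [capturedPower_eq]
  exact (Complex.nonneg_iff.mp (hS.conjTranspose_mul_mul_same V).trace_nonneg).1

theorem capturedPower_add_smul_one (S : Matrix (Fin M) (Fin M) ℂ) (s : ℝ)
    {V : Matrix (Fin M) (Fin p) ℂ} (hV : Vᴴ * V = 1) :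
    capturedPower (S + (s : ℂ) • 1) V = capturedPower S V + s * p := by
  simp [capturedPower_eq, Matrix.mul_add, Matrix.add_mul, hV]

theorem IsDominantBasis.conjTranspose_mul_self {hp : p ≤ M} {C : Matrix (Fin M) (Fin M) ℂ}
    {V : Matrix (Fin M) (Fin p) ℂ} (h : IsDominantBasis hp C V) : Vᴴ * V = 1 := by
  obtain ⟨U, hU, -, -, -, hV⟩ := h
  have hV' : V = U.submatrix id (Fin.castLE hp) := by ext i j; exact hV i j
  have hU' : Uᴴ * U = 1 := Matrix.mem_unitaryGroup_iff'.mp hU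
  rw [hV', Matrix.conjTranspose_submatrix, ← Matrix.submatrix_mul _ _ _ _ _ Function.bijective_id,
    hU', Matrix.submatrix_one _ (Fin.castLE_injective hp)]

theorem capturedPower_diagonalized {U : Matrix (Fin M) (Fin M) ℂ} (lam : Fin M → ℝ)
    (V : Matrix (Fin M) (Fin p) ℂ) :
    capturedPower (U * Matrix.diagonal (fun i => (lam i : ℂ)) * Uᴴ) V =
      ∑ i, lam i * ∑ j, ‖(Uᴴ * V) i j‖ ^ 2 := by
  set W := Uᴴ * V with hW
  have h1 : Vᴴ * (U * Matrix.diagonal (fun i => (lam i : ℂ)) * Uᴴ) * V =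
      Wᴴ * (Matrix.diagonal (fun i => (lam i : ℂ)) * W) := by
    rw [hW, Matrix.conjTranspose_mul, Matrix.conjTranspose_conjTranspose]
    simp only [Matrix.mul_assoc]
  rw [capturedPower_eq, h1, Matrix.trace_mul_comm, Matrix.trace, Complex.re_sum]
  refine Finset.sum_congr rfl fun i _ => ?_
  rw [Matrix.diag_apply, Matrix.mul_assoc, Matrix.diagonal_mul, Complex.re_ofReal_mul,
    Matrix.mul_apply, Complex.re_sum]
  congr 1
  refine Finset.sum_congr rfl fun j _ => ?_
  rw [Matrix.conjTranspose_apply, Complex.star_def, Complex.mul_conj, Complex.ofReal_re,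
    Complex.normSq_eq_norm_sq]

/-- Rows of a matrix with orthonormal columns have norm at most one: `W Wᴴ` is idempotent, so its
diagonal entry `q` satisfies `q ^ 2 ≤ q`. -/
theorem sum_norm_sq_row_le_one {W : Matrix (Fin M) (Fin p) ℂ} (hW : Wᴴ * W = 1) (i : Fin M) :
    ∑ j, ‖W i j‖ ^ 2 ≤ 1 := by
  set P := W * Wᴴ with hP
  have hdiag : P i i = ((∑ j, ‖W i j‖ ^ 2 : ℝ) : ℂ) := by
    rw [hP, Matrix.mul_apply]
    push_cast
    refine Finset.sum_congr rfl fun j _ => ?_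
    rw [Matrix.conjTranspose_apply, Complex.star_def, Complex.mul_conj, Complex.normSq_eq_norm_sq]
    push_cast; rfl
  have hH : Pᴴ = P := by simp [hP]
  have hsq : P * Pᴴ = P := by
    rw [hH, hP, Matrix.mul_assoc, ← Matrix.mul_assoc Wᴴ, hW, Matrix.one_mul]
  have h2 : ∑ k, ‖P i k‖ ^ 2 = ∑ j, ‖W i j‖ ^ 2 := by
    have h3 := congrFun (congrFun hsq i) i
    rw [hdiag, Matrix.mul_apply] at h3
    have h4 := congrArg Complex.re h3
    rw [Complex.ofReal_re, Complex.re_sum] at h4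
    rw [← h4]
    refine Finset.sum_congr rfl fun j _ => ?_
    rw [Matrix.conjTranspose_apply, Complex.star_def, Complex.mul_conj, Complex.ofReal_re,
      Complex.normSq_eq_norm_sq]
  have h5 : ‖P i i‖ ^ 2 ≤ ∑ k, ‖P i k‖ ^ 2 :=
    Finset.single_le_sum (f := fun k => ‖P i k‖ ^ 2) (fun _ _ => by positivity)
      (Finset.mem_univ i)
  rw [h2, hdiag, Complex.norm_real, Real.norm_eq_abs, sq_abs] at h5
  nlinarith

theorem sum_norm_sq_eq {W : Matrix (Fin M) (Fin p) ℂ} (hW : Wᴴ * W = 1) :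
    ∑ i, ∑ j, ‖W i j‖ ^ 2 = p := by
  rw [← innerRe_self_eq_sum, innerRe, Matrix.trace_mul_comm, hW]
  simp

/-- Ky Fan's maximum principle: dominant eigenvectors maximize the captured power. -/
theorem IsDominantBasis.capturedPower_le {hp : p ≤ M} (hp1 : 1 ≤ p)
    {C : Matrix (Fin M) (Fin M) ℂ} {V V' : Matrix (Fin M) (Fin p) ℂ}
    (h : IsDominantBasis hp C V') (hV : Vᴴ * V = 1) :
    capturedPower C V ≤ capturedPower C V' := by
  have hV'1 := h.conjTranspose_mul_self
  obtain ⟨U, hU, lam, hlam, rfl, hV'⟩ := h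
  have hU' : Uᴴ * U = 1 := Matrix.mem_unitaryGroup_iff'.mp hU
  have hU'' : U * Uᴴ = 1 := Matrix.mem_unitaryGroup_iff.mp hU
  have horth : ∀ A : Matrix (Fin M) (Fin p) ℂ, Aᴴ * A = 1 → (Uᴴ * A)ᴴ * (Uᴴ * A) = 1 := by
    intro A hA
    rw [Matrix.conjTranspose_mul, Matrix.conjTranspose_conjTranspose, Matrix.mul_assoc,
      ← Matrix.mul_assoc U, hU'', Matrix.one_mul, hA]
  rw [capturedPower_diagonalized, capturedPower_diagonalized]
  set q : Fin M → ℝ := fun i => ∑ j, ‖(Uᴴ * V) i j‖ ^ 2 with hq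
  set q' : Fin M → ℝ := fun i => ∑ j, ‖(Uᴴ * V') i j‖ ^ 2 with hq'
  have hq1 : ∀ i, q i ≤ 1 := sum_norm_sq_row_le_one (horth V hV)
  have hq0 : ∀ i, 0 ≤ q i := fun i => by positivity
  have hsum : ∑ i, (q' i - q i) = 0 := by
    rw [Finset.sum_sub_distrib, hq, hq', sum_norm_sq_eq (horth V hV),
      sum_norm_sq_eq (horth V' hV'1), sub_self]
  have hW' : Uᴴ * V' = (1 : Matrix (Fin M) (Fin M) ℂ).submatrix id (Fin.castLE hp) := by
    have e : V' = U.submatrix id (Fin.castLE hp) := by ext i j; exact hV' i j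
    rw [e, ← hU', Matrix.submatrix_mul _ _ _ _ _ Function.bijective_id, Matrix.submatrix_id_id]
  have hlow : ∀ i : Fin M, (i : ℕ) < p → q' i = 1 := by
    intro i hi
    simp only [hq', hW', Matrix.submatrix_apply, id, Matrix.one_apply]
    rw [Finset.sum_eq_single ⟨i, hi⟩]
    · simp
    · intro j _ hj
      have : i ≠ Fin.castLE hp j := by
        rintro rfl; exact hj rfl
      simp [this]
    · simp
  have hhigh : ∀ i : Fin M, p ≤ (i : ℕ) → q' i = 0 := by
    intro i hi
    simp only [hq', hW', Matrix.submatrix_apply, id, Matrix.one_apply]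
    refine Finset.sum_eq_zero fun j _ => ?_
    have : i ≠ Fin.castLE hp j := by
      rintro rfl; exact absurd j.2 (not_lt.mpr hi)
    simp [this]
  -- Subtract the smallest of the `p` dominant eigenvalues: `q' - q` sums to zero.
  set i0 : Fin M := ⟨p - 1, by omega⟩
  have hterm : ∀ i, 0 ≤ (lam i - lam i0) * (q' i - q i) := by
    intro i
    rcases lt_or_ge (i : ℕ) p with hi | hi
    · have h1 : lam i0 ≤ lam i := hlam (Fin.mk_le_mk.mpr (by omega) : i ≤ i0)
      rw [hlow i hi]
      exact mul_nonneg (by linarith) (by linarith [hq1 i])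
    · have h1 : lam i ≤ lam i0 := hlam (show i0 ≤ i from Fin.mk_le_mk.mpr (by omega))
      rw [hhigh i hi]
      exact mul_nonneg_of_nonpos_of_nonpos (by linarith) (by linarith [hq0 i])
  have hfin : ∑ i, (lam i - lam i0) * (q' i - q i) =
      ∑ i, lam i * q' i - ∑ i, lam i * q i := by
    simp only [sub_mul, Finset.sum_sub_distrib, ← Finset.mul_sum, hsum]
    rw [← Finset.sum_sub_distrib]
    simp [mul_sub, Finset.sum_sub_distrib]
  linarith [Finset.sum_nonneg fun i (_ : i ∈ Finset.univ) => hterm i]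

/-- The squared Frobenius distance of two projections of rank `p` is at most `2 p`. -/
theorem innerRe_sub_projections_le {V V' : Matrix (Fin M) (Fin p) ℂ} (hV : Vᴴ * V = 1)
    (hV' : V'ᴴ * V' = 1) :
    innerRe (V * Vᴴ - V' * V'ᴴ) (V * Vᴴ - V' * V'ᴴ) ≤ 2 * p := by
  have h1 : ∀ A : Matrix (Fin M) (Fin p) ℂ, Aᴴ * A = 1 → innerRe (A * Aᴴ) (A * Aᴴ) = p := by
    intro A hA
    rw [← capturedPower, capturedPower_eq, ← Matrix.mul_assoc, hA, Matrix.one_mul, hA]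
    simp
  have h2 : 0 ≤ innerRe (V * Vᴴ) (V' * V'ᴴ) :=
    capturedPower_nonneg (Matrix.posSemidef_self_mul_conjTranspose V) V'
  simp only [innerRe_sub_left, innerRe_sub_right, h1 V hV, h1 V' hV',
    innerRe_comm (V' * V'ᴴ) (V * Vᴴ)]
  linarith

/-- The power lost by using the dominant eigenvectors of `C` instead of `V` is controlled by the
distance of `C` from `S`, up to a multiple of the identity. -/
theorem capturedPower_sub_le {hp : p ≤ M} (hp1 : 1 ≤ p) {S C : Matrix (Fin M) (Fin M) ℂ} (s : ℝ)
    {V V' : Matrix (Fin M) (Fin p) ℂ} (hV : Vᴴ * V = 1) (h : IsDominantBasis hp C V') :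
    capturedPower S V - capturedPower S V' ≤
      √(innerRe (C - (S + (s : ℂ) • 1)) (C - (S + (s : ℂ) • 1))) * √(2 * p) := by
  have hV' := h.conjTranspose_mul_self
  have h1 := h.capturedPower_le hp1 hV
  have h2 := capturedPower_add_smul_one S s hV
  have h3 := capturedPower_add_smul_one S s hV'
  set Cy := S + (s : ℂ) • (1 : Matrix (Fin M) (Fin M) ℂ)
  have h4 := innerRe_le_sqrt_mul_sqrt (C - Cy) (V' * V'ᴴ - V * Vᴴ)
  have h5 := Real.sqrt_le_sqrt (innerRe_sub_projections_le hV' hV)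
  have h6 : innerRe (C - Cy) (V' * V'ᴴ - V * Vᴴ) = capturedPower C V' - capturedPower C V -
      (capturedPower Cy V' - capturedPower Cy V) := by
    simp only [innerRe_sub_left, innerRe_sub_right, capturedPower]; ring
  have h7 := mul_le_mul_of_nonneg_left h5 (Real.sqrt_nonneg (innerRe (C - Cy) (C - Cy)))
  linarith

end Beamformers

end CMP

open scoped Kronecker

namespace CMP

/-! ### The covariance of the snapshots -/

section SignalCov

variable {M : ℕ} {γ : ℝ → ℝ}

theorem steering_mul_conj (i k : ℕ) (u : ℝ) :
    steering i u * conj (steering k u) =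
      Complex.exp (Complex.I * (((i : ℤ) - (k : ℤ) : ℤ) : ℂ) * Real.pi * u) := by
  rw [steering, steering, ← Complex.exp_conj, ← Complex.exp_add]
  congr 1
  simp
  ring

theorem signalCov_diag (i : Fin M) :
    signalCov M γ i i = ((∫ u in Set.Icc (-1 : ℝ) 1, γ u : ℝ) : ℂ) := by
  rw [signalCov, Matrix.of_apply, ← integral_complex_ofReal]
  simp [steering_mul_conj]

theorem trace_signalCov :
    (signalCov M γ).trace = M * ((∫ u in Set.Icc (-1 : ℝ) 1, γ u : ℝ) : ℂ) := by
  simp [Matrix.trace, signalCov_diag]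

theorem integral_channelFun (hγ_nonneg : ∀ u ∈ Set.Icc (-1 : ℝ) 1, 0 ≤ γ u)
    (hγ : IntegrableOn γ (Set.Icc (-1 : ℝ) 1)) (i k : Fin M) :
    ∫ u in Set.Icc (-1 : ℝ) 1, (channelFun hγ i).1 u * conj ((channelFun hγ k).1 u) =
      signalCov M γ i k := by
  rw [signalCov, Matrix.of_apply]
  refine setIntegral_congr_fun measurableSet_Icc fun u hu => ?_
  have h : ((√(γ u) : ℝ) : ℂ) * ((√(γ u) : ℝ) : ℂ) = (γ u : ℂ) := by
    rw [← Complex.ofReal_mul, Real.mul_self_sqrt (hγ_nonneg u hu)]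
  simp only [channelFun, map_mul, Complex.conj_ofReal]
  rw [← h]
  ring

theorem posSemidef_signalCov (hγ_nonneg : ∀ u ∈ Set.Icc (-1 : ℝ) 1, 0 ≤ γ u)
    (hγ : IntegrableOn γ (Set.Icc (-1 : ℝ) 1)) : (signalCov M γ).PosSemidef := by
  have h := (Matrix.posSemidef_gram ℂ
    (fun k : Fin M => (channelFun hγ k).2.toLp (channelFun hγ k).1)).transpose
  have e : signalCov M γ = (Matrix.gram ℂ
      (fun k : Fin M => (channelFun hγ k).2.toLp (channelFun hγ k).1))ᵀ := by
    ext i k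
    rw [Matrix.transpose_apply, Matrix.gram_apply, L2.inner_def,
      ← integral_channelFun hγ_nonneg hγ]
    refine integral_congr_ae ?_
    filter_upwards [(channelFun hγ i).2.coeFn_toLp, (channelFun hγ k).2.coeFn_toLp] with u h1 h2
    rw [h1, h2, RCLike.inner_apply]
  rw [e]
  exact h

theorem signalCov_mem_toeplitzCone (hγ_nonneg : ∀ u ∈ Set.Icc (-1 : ℝ) 1, 0 ≤ γ u)
    (hγ : IntegrableOn γ (Set.Icc (-1 : ℝ) 1)) : signalCov M γ ∈ toeplitzCone M :=
  ⟨posSemidef_signalCov hγ_nonneg hγ, fun d => ∫ u in Set.Icc (-1 : ℝ) 1,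
    (γ u : ℂ) * Complex.exp (Complex.I * (d : ℂ) * Real.pi * u), fun i j => by
      simp only [signalCov, Matrix.of_apply, steering_mul_conj]⟩

theorem IsBestBeamformer.capturedPower_pos {p : ℕ} (hp1 : 1 ≤ p) (hpM : p ≤ M)
    (hγ_pos : 0 < ∫ u in Set.Icc (-1 : ℝ) 1, γ u) {V : Matrix (Fin M) (Fin p) ℂ}
    (hV : IsBestBeamformer (signalCov M γ) V) : 0 < capturedPower (signalCov M γ) V := by
  -- The first `p` coordinate vectors capture the power `p ∫ γ`.
  set U : Matrix (Fin M) (Fin p) ℂ :=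
    (1 : Matrix (Fin M) (Fin M) ℂ).submatrix id (Fin.castLE hpM)
  have hUS : ∀ S : Matrix (Fin M) (Fin M) ℂ,
      Uᴴ * S * U = S.submatrix (Fin.castLE hpM) (Fin.castLE hpM) := by
    intro S
    ext i j
    simp [U, Matrix.mul_apply, Matrix.one_apply]
  have hU : Uᴴ * U = 1 := by
    have h := hUS 1
    rwa [Matrix.mul_one, Matrix.submatrix_one _ (Fin.castLE_injective hpM)] at h
  refine lt_of_lt_of_le ?_ (hV.2 U hU)
  rw [capturedPower_eq, hUS]
  have htr : ((signalCov M γ).submatrix (Fin.castLE hpM) (Fin.castLE hpM)).trace.re =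
      p * ∫ u in Set.Icc (-1 : ℝ) 1, γ u := by
    simp [Matrix.trace, signalCov_diag]
  rw [htr]
  exact mul_pos (by exact_mod_cast hp1) hγ_pos

end SignalCov

theorem posSemidef_snapshotKernel {T M : ℕ} {C : Matrix (Fin M) (Fin M) ℂ} (hC : C.PosSemidef) :
    (Matrix.of fun a b : Fin T × Fin M => if a.1 = b.1 then C a.2 b.2 else 0).PosSemidef := by
  have h := (Matrix.PosSemidef.one (n := Fin T) (R := ℂ)).kronecker hC
  have e : (Matrix.of fun a b : Fin T × Fin M => if a.1 = b.1 then C a.2 b.2 else 0) =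
      (1 : Matrix (Fin T) (Fin T) ℂ) ⊗ₖ C := by
    ext a b
    simp [Matrix.kroneckerMap_apply, Matrix.one_apply]
  rw [e]
  exact h

/-- The entries `y(t)_k` of the snapshots form a circularly symmetric Gaussian family; different
snapshots are uncorrelated and each has covariance `S + σ² I`. -/
theorem isCircularGaussian_received {Ω : Type*} [MeasurableSpace Ω] {μ : Measure Ω}
    [IsProbabilityMeasure μ] {M T : ℕ} {γ : ℝ → ℝ}
    (hγ_nonneg : ∀ u ∈ Set.Icc (-1 : ℝ) 1, 0 ≤ γ u)
    (hγ : IntegrableOn γ (Set.Icc (-1 : ℝ) 1)) {σ : ℝ}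
    {z : Fin T × L2Fun → Ω → ℂ} (hz : IsWhiteNoise μ z)
    {n : Fin T × Fin M → Ω → ℂ} (hn : IsReceiverNoise μ σ n)
    (hzn : IndepFun (fun ω a => z a ω) (fun ω b => n b ω) μ) :
    IsCircularGaussian μ (fun (a : Fin T × Fin M) ω => received hγ z n ω a.2 a.1)
      (fun a b => if a.1 = b.1 then
        (signalCov M γ + ((σ ^ 2 : ℝ) : ℂ) • (1 : Matrix (Fin M) (Fin M) ℂ)) a.2 b.2 else 0) := by
  have h1 := IsCircularGaussian.comp hz
    (fun a : Fin T × Fin M => ((a.1, channelFun hγ a.2) : Fin T × L2Fun))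
  simp only [integral_channelFun hγ_nonneg hγ] at h1
  have hind : IndepFun (fun ω (a : Fin T × Fin M) => z (a.1, channelFun hγ a.2) ω)
      (fun ω a => n a ω) μ := by
    have hφ : Measurable (fun (x : Fin T × L2Fun → ℂ) (a : Fin T × Fin M) =>
        x (a.1, channelFun hγ a.2)) :=
      measurable_pi_lambda _ fun a => measurable_pi_apply _
    exact hzn.comp hφ measurable_id
  have hnK : (Matrix.of fun a b : Fin T × Fin M =>
      if a = b then ((σ ^ 2 : ℝ) : ℂ) else 0).PosSemidef := by
    have h := (Matrix.PosSemidef.one (n := Fin T × Fin M) (R := ℂ)).smul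
      (show (0 : ℂ) ≤ ((σ ^ 2 : ℝ) : ℂ) by exact_mod_cast sq_nonneg σ)
    have e : (Matrix.of fun a b : Fin T × Fin M => if a = b then ((σ ^ 2 : ℝ) : ℂ) else 0) =
        ((σ ^ 2 : ℝ) : ℂ) • 1 := by
      ext a b
      simp [Matrix.one_apply]
    rw [e]
    exact h
  have h2 := h1.add hn (posSemidef_snapshotKernel (posSemidef_signalCov hγ_nonneg hγ)) hnK hind
  have e : (fun a b : Fin T × Fin M => if a.1 = b.1 then
      (signalCov M γ + ((σ ^ 2 : ℝ) : ℂ) • (1 : Matrix (Fin M) (Fin M) ℂ)) a.2 b.2 else 0) =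
      fun a b => (if a.1 = b.1 then signalCov M γ a.2 b.2 else 0) +
        if a = b then ((σ ^ 2 : ℝ) : ℂ) else 0 := by
    ext a b
    by_cases h : a.1 = b.1
    · simp [h, Matrix.one_apply, Prod.ext_iff]
    · simp [h, Prod.ext_iff]
  rw [e]
  exact h2

/-! ### Mean square error of the sample covariance -/

section SampleCov

variable {Ω : Type*} [MeasurableSpace Ω] {μ : Measure Ω} [IsProbabilityMeasure μ] {M T : ℕ}
  {Y : Ω → Matrix (Fin M) (Fin T) ℂ} {C : Matrix (Fin M) (Fin M) ℂ}

theorem integrable_sampleCov_product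
    (h : IsCircularGaussian μ (fun (a : Fin T × Fin M) ω => Y ω a.2 a.1)
      (fun a b => if a.1 = b.1 then C a.2 b.2 else 0)) (i j : Fin M) (t s : Fin T) :
    Integrable (fun ω => (Y ω i t * conj (Y ω j t) - C i j) *
      (Y ω j s * conj (Y ω i s) - conj (C i j))) μ := by
  have e : ∀ ω, (Y ω i t * conj (Y ω j t) - C i j) * (Y ω j s * conj (Y ω i s) - conj (C i j)) =
      Y ω i t * conj (Y ω j t) * (Y ω j s * conj (Y ω i s)) -
        Y ω i t * conj (Y ω j t) * conj (C i j) - C i j * (Y ω j s * conj (Y ω i s)) +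
        C i j * conj (C i j) := fun ω => by ring
  simp_rw [e]
  exact (((h.integrable_four (t, i) (t, j) (s, j) (s, i)).sub
    ((h.integrable_mul_conj (t, i) (t, j)).mul_const _)).sub
    ((h.integrable_mul_conj (s, j) (s, i)).const_mul _)).add (integrable_const _)

theorem integral_sampleCov_product
    (h : IsCircularGaussian μ (fun (a : Fin T × Fin M) ω => Y ω a.2 a.1)
      (fun a b => if a.1 = b.1 then C a.2 b.2 else 0)) (hC : C.PosSemidef)
    (i j : Fin M) (t s : Fin T) :
    ∫ ω, (Y ω i t * conj (Y ω j t) - C i j) * (Y ω j s * conj (Y ω i s) - conj (C i j)) ∂μ =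
      if t = s then C i i * C j j else 0 := by
  have hK := posSemidef_snapshotKernel (T := T) hC
  have e : ∀ ω, (Y ω i t * conj (Y ω j t) - C i j) * (Y ω j s * conj (Y ω i s) - conj (C i j)) =
      Y ω i t * conj (Y ω j t) * (Y ω j s * conj (Y ω i s)) -
        Y ω i t * conj (Y ω j t) * conj (C i j) - C i j * (Y ω j s * conj (Y ω i s)) +
        C i j * conj (C i j) := fun ω => by ring
  have i1 : Integrable (fun ω => Y ω i t * conj (Y ω j t) * (Y ω j s * conj (Y ω i s))) μ :=
    h.integrable_four (t, i) (t, j) (s, j) (s, i)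
  have i2 : Integrable (fun ω => Y ω i t * conj (Y ω j t) * conj (C i j)) μ :=
    (h.integrable_mul_conj (t, i) (t, j)).mul_const (conj (C i j))
  have i3 : Integrable (fun ω => C i j * (Y ω j s * conj (Y ω i s))) μ :=
    (h.integrable_mul_conj (s, j) (s, i)).const_mul (C i j)
  have v1 := h.integral_four hK (t, i) (t, j) (s, j) (s, i)
  have v2 := h.integral_mul_conj hK (t, i) (t, j)
  have v3 := h.integral_mul_conj hK (s, j) (s, i)
  have hji : C j i = conj (C i j) := (hC.isHermitian.apply j i).symm
  simp_rw [e]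
  rw [integral_add (by fun_prop) (by fun_prop), integral_sub (by fun_prop) (by fun_prop),
    integral_sub (by fun_prop) (by fun_prop), integral_mul_const, integral_const_mul]
  simp only at v1 v2 v3
  rw [v1, v2, v3]
  by_cases hts : t = s
  · simp [hts, hji]
  · simp [hts, Ne.symm hts, hji]

theorem ofReal_norm_sampleCov_sub_sq (hT : 1 ≤ T) (Y : Matrix (Fin M) (Fin T) ℂ) (i j : Fin M) :
    ((‖(sampleCov Y - C) i j‖ ^ 2 : ℝ) : ℂ) = ∑ t, ∑ s, ((T : ℂ) ^ 2)⁻¹ *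
      ((Y i t * conj (Y j t) - C i j) * (Y j s * conj (Y i s) - conj (C i j))) := by
  have hT0 : (T : ℂ) ≠ 0 := by exact_mod_cast (by omega : T ≠ 0)
  have e : (sampleCov Y - C) i j = (T : ℂ)⁻¹ * ∑ t, (Y i t * conj (Y j t) - C i j) := by
    rw [Finset.sum_sub_distrib, mul_sub]
    simp [sampleCov, Matrix.mul_apply, hT0]
  have e' : conj ((sampleCov Y - C) i j) =
      (T : ℂ)⁻¹ * ∑ s, (Y j s * conj (Y i s) - conj (C i j)) := by
    rw [e]
    simp [map_sum, mul_comm]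
  rw [← Complex.normSq_eq_norm_sq, ← Complex.mul_conj, e', e]
  simp_rw [← Finset.mul_sum]
  rw [← Finset.sum_mul]
  field_simp

theorem integrable_norm_sampleCov_sub_sq (hT : 1 ≤ T)
    (h : IsCircularGaussian μ (fun (a : Fin T × Fin M) ω => Y ω a.2 a.1)
      (fun a b => if a.1 = b.1 then C a.2 b.2 else 0)) (i j : Fin M) :
    Integrable (fun ω => ‖(sampleCov (Y ω) - C) i j‖ ^ 2) μ := by
  have h1 : Integrable (fun ω => ((‖(sampleCov (Y ω) - C) i j‖ ^ 2 : ℝ) : ℂ)) μ := by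
    simp_rw [ofReal_norm_sampleCov_sub_sq hT]
    exact integrable_finsetSum _ fun t _ => integrable_finsetSum _ fun s _ =>
      (integrable_sampleCov_product h i j t s).const_mul _
  exact h1.re

theorem integral_norm_sampleCov_sub_sq (hT : 1 ≤ T)
    (h : IsCircularGaussian μ (fun (a : Fin T × Fin M) ω => Y ω a.2 a.1)
      (fun a b => if a.1 = b.1 then C a.2 b.2 else 0)) (hC : C.PosSemidef) (i j : Fin M) :
    ∫ ω, ‖(sampleCov (Y ω) - C) i j‖ ^ 2 ∂μ = (C i i * C j j).re / T := by
  have hT0 : (T : ℂ) ≠ 0 := by exact_mod_cast (by omega : T ≠ 0)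
  have h1 : ((∫ ω, ‖(sampleCov (Y ω) - C) i j‖ ^ 2 ∂μ : ℝ) : ℂ) = (C i i * C j j) / T := by
    rw [← integral_complex_ofReal]
    simp_rw [ofReal_norm_sampleCov_sub_sq hT]
    have hint := fun t s => (integrable_sampleCov_product h i j t s).const_mul ((T : ℂ) ^ 2)⁻¹
    rw [integral_finsetSum _ fun t _ => integrable_finsetSum _ fun s _ => hint t s]
    simp_rw [integral_finsetSum _ fun s _ => hint _ s, integral_const_mul,
      integral_sampleCov_product h hC]
    simp
    field_simp
  have h2 := congrArg Complex.re h1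
  rw [Complex.ofReal_re] at h2
  rw [h2, ← Complex.ofReal_natCast, Complex.div_ofReal_re]

theorem integrable_seminormB_sampleCov_sub_sq (hT : 1 ≤ T) (D : Finset (Fin M))
    (h : IsCircularGaussian μ (fun (a : Fin T × Fin M) ω => Y ω a.2 a.1)
      (fun a b => if a.1 = b.1 then C a.2 b.2 else 0)) :
    Integrable (fun ω => seminormB D (sampleCov (Y ω) - C) ^ 2) μ := by
  simp_rw [seminormB_sq]
  exact integrable_finsetSum _ fun i _ => integrable_finsetSum _ fun j _ =>
    integrable_norm_sampleCov_sub_sq hT h i j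

theorem integral_seminormB_sampleCov_sub_sq (hT : 1 ≤ T) (D : Finset (Fin M))
    (h : IsCircularGaussian μ (fun (a : Fin T × Fin M) ω => Y ω a.2 a.1)
      (fun a b => if a.1 = b.1 then C a.2 b.2 else 0)) (hC : C.PosSemidef) {c : ℝ}
    (hc : ∀ i, C i i = c) :
    ∫ ω, seminormB D (sampleCov (Y ω) - C) ^ 2 ∂μ = (D.card * c) ^ 2 / T := by
  have hint := integrable_norm_sampleCov_sub_sq hT h
  simp_rw [seminormB_sq]
  rw [integral_finsetSum _ fun i _ => integrable_finsetSum _ fun j _ => hint i j]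
  simp_rw [integral_finsetSum _ fun j _ => hint _ j, integral_norm_sampleCov_sub_sq hT h hC, hc,
    ← Complex.ofReal_mul, Complex.ofReal_re]
  simp
  ring

end SampleCov

/-! ### The relative efficiency -/

theorem measurable_capturedPower {Ω : Type*} [MeasurableSpace Ω] {M p : ℕ}
    (S : Matrix (Fin M) (Fin M) ℂ) {W : Ω → Matrix (Fin M) (Fin p) ℂ}
    (hW : ∀ i j, Measurable fun ω => W ω i j) : Measurable fun ω => capturedPower S (W ω) := by
  have hc : Continuous fun x : Fin M → Fin p → ℂ => capturedPower S (Matrix.of x) := by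
    have h : Continuous fun x : Fin M → Fin p → ℂ => (Matrix.of x : Matrix (Fin M) (Fin p) ℂ) :=
      continuous_id
    unfold capturedPower innerRe
    fun_prop
  exact hc.measurable.comp (measurable_pi_lambda _ fun i => measurable_pi_lambda _ fun j => hW i j)

theorem IsCMPEstimator.measurable_capturedPower {Ω : Type*} [MeasurableSpace Ω] {M T p : ℕ}
    {hp : p ≤ M} {D : Finset (Fin M)}
    {est : Matrix (Fin D.card) (Fin T) ℂ → Matrix (Fin M) (Fin p) ℂ}
    (hest : IsCMPEstimator hp D est) (S : Matrix (Fin M) (Fin M) ℂ)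
    {Y : Ω → Matrix (Fin M) (Fin T) ℂ} (hY : ∀ i t, Measurable fun ω => Y ω i t) :
    Measurable fun ω => capturedPower S (est (samplingMatrix D * Y ω)) := by
  refine CMP.measurable_capturedPower S fun i j => ?_
  refine (hest.measurable i j).comp (measurable_pi_lambda _ fun k => measurable_pi_lambda _
    fun t => ?_)
  change Measurable fun ω => (samplingMatrix D * Y ω) k t
  simp_rw [Matrix.mul_apply]
  exact Finset.measurable_sum _ fun l _ => (hY l t).const_mul _

/-- The square of the relative loss of power is at most a multiple of the squared error of the
sampled sample covariance. -/
theorem IsCMPEstimator.one_sub_relEfficiency_sq_le {M T p : ℕ} (hp1 : 1 ≤ p) {hp : p ≤ M}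
    {D : Finset (Fin M)} (hcover : IsCompleteCover D)
    {est : Matrix (Fin D.card) (Fin T) ℂ → Matrix (Fin M) (Fin p) ℂ}
    (hest : IsCMPEstimator hp D est) {S : Matrix (Fin M) (Fin M) ℂ} (hS : S ∈ toeplitzCone M)
    {s : ℝ} (hs : 0 ≤ s) {V : Matrix (Fin M) (Fin p) ℂ} (hV : IsBestBeamformer S V)
    (hpos : 0 < capturedPower S V) (Y : Matrix (Fin M) (Fin T) ℂ) :
    0 ≤ relEfficiency S V (est (samplingMatrix D * Y)) ∧
    relEfficiency S V (est (samplingMatrix D * Y)) ≤ 1 ∧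
    (1 - relEfficiency S V (est (samplingMatrix D * Y))) ^ 2 ≤
      2 * p * M / capturedPower S V ^ 2 *
        seminormB D (sampleCov Y - (S + (s : ℂ) • 1)) ^ 2 := by
  obtain ⟨C, hC, hdom⟩ := hest.dominant Y
  set V' := est (samplingMatrix D * Y)
  have hle := hV.2 V' hdom.conjTranspose_mul_self
  have hnonneg := capturedPower_nonneg hS.1 V'
  have h1 := capturedPower_sub_le (S := S) hp1 s hV.1 hdom
  have hL : S + (s : ℂ) • (1 : Matrix (Fin M) (Fin M) ℂ) ∈ toeplitzCone M :=
    add_mem_toeplitzCone hS (smul_mem_toeplitzCone one_mem_toeplitzCone hs)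
  have h2 := hC.innerRe_sub_le hcover hL
  have h0 := innerRe_self_nonneg (C - (S + (s : ℂ) • 1))
  refine ⟨div_nonneg hnonneg hpos.le, (div_le_one hpos).mpr hle, ?_⟩
  have h3 := pow_le_pow_left₀ (sub_nonneg.mpr hle) h1 2
  rw [mul_pow, Real.sq_sqrt h0, Real.sq_sqrt (by positivity)] at h3
  have e : 1 - relEfficiency S V V' =
      (capturedPower S V - capturedPower S V') / capturedPower S V := by
    rw [relEfficiency]; field_simp
  rw [e, div_pow, div_mul_eq_mul_div]
  gcongr
  have h4 := mul_le_mul_of_nonneg_right h2 (show (0 : ℝ) ≤ 2 * p by positivity)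
  linarith

/-- Mean and variance of a random variable with values in `[0, 1]` whose mean square distance
from `1` is at most `R ^ 2`. -/
theorem mean_variance_of_integral_one_sub_sq_le {Ω : Type*} [MeasurableSpace Ω] {μ : Measure Ω}
    [IsProbabilityMeasure μ] {f : Ω → ℝ} (hf : Measurable f) (h0 : ∀ ω, 0 ≤ f ω)
    (h1 : ∀ ω, f ω ≤ 1) {R : ℝ} (hR : 0 ≤ R) (h : ∫ ω, (1 - f ω) ^ 2 ∂μ ≤ R ^ 2) :
    MemLp f 2 μ ∧ max (1 - R) 0 ≤ ∫ ω, f ω ∂μ ∧ variance f μ ≤ R ^ 2 := by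
  have hmem : MemLp f 2 μ := MemLp.of_bound hf.aestronglyMeasurable 1
    (Filter.Eventually.of_forall fun ω => by
      rw [Real.norm_of_nonneg (h0 ω)]; exact h1 ω)
  have hg : MemLp (fun ω => 1 - f ω) 2 μ := (memLp_const 1).sub hmem
  have hmean : ∫ ω, (1 - f ω) ∂μ = 1 - ∫ ω, f ω ∂μ := by
    rw [integral_sub (integrable_const _) (hmem.integrable (by norm_num))]; simp
  have hvar := variance_eq_sub hg
  have hvar2 : variance (fun ω => 1 - f ω) μ = variance f μ :=
    variance_const_sub hf.aestronglyMeasurable 1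
  simp only [Pi.pow_apply, hmean, hvar2] at hvar
  have hv0 := variance_nonneg f μ
  refine ⟨hmem, max_le ?_ (integral_nonneg h0), by nlinarith⟩
  have := abs_le_of_sq_le_sq' (show (1 - ∫ ω, f ω ∂μ) ^ 2 ≤ R ^ 2 by linarith) hR
  linarith [this.2]

end CMP

theorem theorem1 {Ω : Type*} [MeasurableSpace Ω] (μ : Measure Ω) [IsProbabilityMeasure μ]
    (M T p : ℕ) (hT : 1 ≤ T) (hp1 : 1 ≤ p) (hpM : p ≤ M)
    -- the sampled antennas: a complete cover of size at most `2 √M`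
    (D : Finset (Fin M)) (hcover : CMP.IsCompleteCover D)
    (hcard : (D.card : ℝ) ≤ 2 * Real.sqrt M)
    -- the scattering function, with positive total power
    (γ : ℝ → ℝ) (hγ_nonneg : ∀ u ∈ Set.Icc (-1 : ℝ) 1, 0 ≤ γ u)
    (hγ : IntegrableOn γ (Set.Icc (-1 : ℝ) 1))
    (hγ_pos : 0 < ∫ u in Set.Icc (-1 : ℝ) 1, γ u)
    (σ : ℝ) (hσ : 0 < σ)
    -- the white Gaussian scattering process and the independent receiver noise
    (z : Fin T × CMP.L2Fun → Ω → ℂ) (hz : CMP.IsWhiteNoise μ z)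
    (n : Fin T × Fin M → Ω → ℂ) (hn : CMP.IsReceiverNoise μ σ n)
    (hzn : IndepFun (fun ω a => z a ω) (fun ω b => n b ω) μ)
    -- the best beamformer and the estimated one
    (V : Matrix (Fin M) (Fin p) ℂ) (hV : CMP.IsBestBeamformer (CMP.signalCov M γ) V)
    (est : Matrix (Fin D.card) (Fin T) ℂ → Matrix (Fin M) (Fin p) ℂ)
    (hest : CMP.IsCMPEstimator hpM D est) :
    -- square integrability of `Γ_p`, so that its mean and variance are meaningful
    MemLp (fun ω => CMP.relEfficiency (CMP.signalCov M γ) V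
        (est (CMP.samplingMatrix D * CMP.received hγ z n ω))) 2 μ ∧
      max (1 - 2 * Real.sqrt (2 * p) / (CMP.efficiency (CMP.signalCov M γ) V * Real.sqrt T) *
          (1 + 1 / CMP.snr M γ σ)) 0 ≤
        ∫ ω, CMP.relEfficiency (CMP.signalCov M γ) V
          (est (CMP.samplingMatrix D * CMP.received hγ z n ω)) ∂μ ∧
      variance (fun ω => CMP.relEfficiency (CMP.signalCov M γ) V
          (est (CMP.samplingMatrix D * CMP.received hγ z n ω))) μ ≤
        8 * p / (T * CMP.efficiency (CMP.signalCov M γ) V ^ 2) * (1 + 1 / CMP.snr M γ σ) ^ 2 := by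
  have hM1 : 1 ≤ M := hp1.trans hpM
  set S := CMP.signalCov M γ
  set g := ∫ u in Set.Icc (-1 : ℝ) 1, γ u
  have hS : S ∈ CMP.toeplitzCone M := CMP.signalCov_mem_toeplitzCone hγ_nonneg hγ
  have hpos : 0 < CMP.capturedPower S V := hV.capturedPower_pos hp1 hpM hγ_pos
  have hG := CMP.isCircularGaussian_received hγ_nonneg hγ hz hn hzn
  have hCy : (S + ((σ ^ 2 : ℝ) : ℂ) • (1 : Matrix (Fin M) (Fin M) ℂ)).PosSemidef :=
    (CMP.add_mem_toeplitzCone hS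
      (CMP.smul_mem_toeplitzCone CMP.one_mem_toeplitzCone (sq_nonneg σ))).1
  have hdiag : ∀ i, (S + ((σ ^ 2 : ℝ) : ℂ) • (1 : Matrix (Fin M) (Fin M) ℂ)) i i =
      ((g + σ ^ 2 : ℝ) : ℂ) := by
    intro i
    have h : S i i = (g : ℂ) := CMP.signalCov_diag i
    simp [h]
  have hpt := fun ω => hest.one_sub_relEfficiency_sq_le hp1 hcover hS (sq_nonneg σ) hV hpos
    (CMP.received hγ z n ω)
  have hint := CMP.integrable_seminormB_sampleCov_sub_sq
    (C := S + ((σ ^ 2 : ℝ) : ℂ) • (1 : Matrix (Fin M) (Fin M) ℂ)) hT D hG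
  have hE := CMP.integral_seminormB_sampleCov_sub_sq
    (C := S + ((σ ^ 2 : ℝ) : ℂ) • (1 : Matrix (Fin M) (Fin M) ℂ)) hT D hG hCy hdiag
  have hmeas : Measurable fun ω => CMP.relEfficiency S V
      (est (CMP.samplingMatrix D * CMP.received hγ z n ω)) :=
    (hest.measurable_capturedPower S fun i t => hG.measurable (t, i)).div_const _
  have htrS : S.trace.re = M * g := by
    rw [CMP.trace_signalCov]
    simp [g]
  have hsnr : 1 + 1 / CMP.snr M γ σ = (g + σ ^ 2) / g := by
    have h1 : (M : ℝ) ≠ 0 := by positivity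
    have h2 : (((σ ^ 2 : ℝ) : ℂ) • (1 : Matrix (Fin M) (Fin M) ℂ)).trace.re = σ ^ 2 * M := by
      rw [Matrix.trace_smul, Matrix.trace_one, smul_eq_mul, Complex.re_ofReal_mul]
      simp
    rw [CMP.snr, h2, htrS]
    field_simp
  have hη : CMP.efficiency S V = CMP.capturedPower S V / (M * g) := by
    rw [CMP.efficiency, htrS]
  have hM0 : (0 : ℝ) < M := by exact_mod_cast hM1
  have hT0 : (0 : ℝ) < T := by exact_mod_cast hT
  have hη0 : 0 < CMP.efficiency S V := by rw [hη]; positivity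
  have hsnr0 : 0 ≤ 1 + 1 / CMP.snr M γ σ := by rw [hsnr]; positivity
  have hR2 : (2 * Real.sqrt (2 * p) / (CMP.efficiency S V * Real.sqrt T) *
      (1 + 1 / CMP.snr M γ σ)) ^ 2 =
      8 * p / (T * CMP.efficiency S V ^ 2) * (1 + 1 / CMP.snr M γ σ) ^ 2 := by
    rw [mul_pow, div_pow, mul_pow, mul_pow, Real.sq_sqrt (by positivity),
      Real.sq_sqrt (by positivity)]
    ring
  rw [← hR2]
  refine CMP.mean_variance_of_integral_one_sub_sq_le hmeas (fun ω => (hpt ω).1)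
    (fun ω => (hpt ω).2.1) (by positivity) ?_
  have hcard2 : (D.card : ℝ) ^ 2 ≤ 4 * M := by
    have h := pow_le_pow_left₀ (Nat.cast_nonneg _) hcard 2
    rw [mul_pow, Real.sq_sqrt hM0.le] at h
    linarith
  calc _ ≤ ∫ ω, 2 * p * M / CMP.capturedPower S V ^ 2 *
        CMP.seminormB D (CMP.sampleCov (CMP.received hγ z n ω) -
          (S + ((σ ^ 2 : ℝ) : ℂ) • 1)) ^ 2 ∂μ :=
        integral_mono_of_nonneg (Filter.Eventually.of_forall fun ω => sq_nonneg _)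
          (hint.const_mul _) (Filter.Eventually.of_forall fun ω => (hpt ω).2.2)
    _ = 2 * p * M / CMP.capturedPower S V ^ 2 * ((D.card * (g + σ ^ 2)) ^ 2 / T) := by
        rw [integral_const_mul, hE]
    _ ≤ 2 * p * M / CMP.capturedPower S V ^ 2 * (4 * M * (g + σ ^ 2) ^ 2 / T) := by
        rw [mul_pow]
        gcongr
    _ = _ := by
        rw [hR2, hη, hsnr]
        field_simp
        ring
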